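/- Let $n\ge 3$, $p\ge 0$, and let $f:M^n\to N^{n+p}(\tilde c)$ be a submanifold (a smooth isometric immersion of Riemannian manifolds) of a Riemannian manifold $N$ of constant sectional curvature $\tilde c$, with second fundamental form $h$. For $x\in M$ and an orthonormal basis $e_1,\dots,e_n$ of $T_xM$ let $$\rho=\frac{2}{n(n-1)}\sum_{i<j}K(e_i\wedge e_j),\qquad \mathcal C=\frac1n\sum_{i,j=1}^n\|h(e_i,e_j)\|^2$$ be the normalized scalar curvature and the Casorati curvature at $x$. For a hyperplane $L\subset T_xM$ with orthonormal basis $u_1,\dots,u_{n-1}$ put $\mathcal C(L)=\frac1{n-1}\sum_{i,j=1}^{n-1}\|h(u_i,u_j)\|^2$, and define $$\hat\delta_c(n-1)=2\,\mathcal C-\frac{2n-1}{2n}\sup_L\mathcal C(L),\qquad \delta_C(n-1)=\frac12\,\mathcal C+\frac{n+1}{2n}\inf_L\mathcal C(L),$$ where $L$ runs over all hyperplanes of $T_xM$. Call $M$ Einstein if there is a constant $\mu$ with $\mathrm{Ric}=\mu g$ on $M$, and totally geodesic if $h=0$. (a) If $\rho=\hat\delta_c(n-1)+\tilde c$ at every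 point of $M$, then $M$ is Einstein if and only if it is totally geodesic. (b) If $\rho=\delta_C(n-1)+\tilde c$ at every point of $M$, then $M$ is Einstein if and only if it is totally geodesic. -/

import Mathlib

open scoped Manifold ContDiff Bundle

noncomputable section

namespace Casorati

/-! ### Riemannian calculus on a normed space

`G y` is a metric tensor at the point `y`; all formulas are the classical coordinate formulas. -/

section Coordinates

variable {E : Type*} [NormedAddCommGroup E] [NormedSpace ℝ E]

/-- The Christoffel symbols (of the first kind) of `G`, as a covector:
`w ↦ ½ (D_u G(v, w) + D_v G(u, w) - D_w G(u, v))`. -/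
def christoffelLow (G : E → E →L[ℝ] E →L[ℝ] ℝ) (y u v : E) : E →L[ℝ] ℝ :=
  (1 / 2 : ℝ) •
    (fderiv ℝ G y u v + fderiv ℝ G y v u - ((fderiv ℝ G y).flip u).flip v)

/-- The Christoffel symbols (of the second kind) of `G`: the vector `Γ(u, v)` with
`G(Γ(u, v), w) = ½ (D_u G(v, w) + D_v G(u, w) - D_w G(u, v))` for all `w`. In other words,
the Levi-Civita derivative `∇_u v` of the constant vector field `v`. -/
def christoffel (G : E → E →L[ℝ] E →L[ℝ] ℝ) (y u v : E) : E :=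
  (G y).inverse (christoffelLow G y u v)

/-- The curvature operator `R(u, v) w = ∇_u ∇_v w - ∇_v ∇_u w` of `G`
(for constant vector fields `u`, `v`, `w`). -/
def coordCurvature (G : E → E →L[ℝ] E →L[ℝ] ℝ) (y u v w : E) : E :=
  fderiv ℝ (fun z => christoffel G z v w) y u - fderiv ℝ (fun z => christoffel G z u w) y v
    + christoffel G y u (christoffel G y v w) - christoffel G y v (christoffel G y u w)

end Coordinates

/-! ### Intrinsic curvature of a Riemannian manifold of dimension `m` -/

section Intrinsic

variable (m : ℕ) {M : Type*} [TopologicalSpace M] [ChartedSpace (EuclideanSpace ℝ (Fin m)) M]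
  [Bundle.RiemannianBundle (fun x : M => TangentSpace (𝓡 m) x)]

/-- The Riemannian metric read in the chart at `x₀`: its value at the point `y` of the chart. -/
def chartMetric (x₀ : M) (y : EuclideanSpace ℝ (Fin m)) :
    EuclideanSpace ℝ (Fin m) →L[ℝ] EuclideanSpace ℝ (Fin m) →L[ℝ] ℝ :=
  (innerSL ℝ (E := TangentSpace (𝓡 m) ((extChartAt (𝓡 m) x₀).symm y))).bilinearComp
    (mfderiv 𝓘(ℝ, EuclideanSpace ℝ (Fin m)) (𝓡 m) (extChartAt (𝓡 m) x₀).symm y)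
    (mfderiv 𝓘(ℝ, EuclideanSpace ℝ (Fin m)) (𝓡 m) (extChartAt (𝓡 m) x₀).symm y)

/-- The coordinates of a tangent vector at `x` in the chart at `x`. -/
def toCoord (x : M) (v : TangentSpace (𝓡 m) x) : EuclideanSpace ℝ (Fin m) :=
  mfderiv (𝓡 m) 𝓘(ℝ, EuclideanSpace ℝ (Fin m)) (extChartAt (𝓡 m) x) x v

/-- The `(0,4)` Riemann curvature tensor `⟨R(u, v) w, z⟩` at `x`, computed in the chart at `x`. -/
def riemannTensor (x : M) (u v w z : TangentSpace (𝓡 m) x) : ℝ :=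
  chartMetric m x (extChartAt (𝓡 m) x x)
    (coordCurvature (chartMetric m x) (extChartAt (𝓡 m) x x) (toCoord m x u) (toCoord m x v)
      (toCoord m x w))
    (toCoord m x z)

/-- The sectional curvature of the plane spanned by `u` and `v`. -/
def sectionalCurvature (x : M) (u v : TangentSpace (𝓡 m) x) : ℝ :=
  riemannTensor m x u v v u / (inner ℝ u u * inner ℝ v v - inner ℝ u v ^ 2)

variable (M) in
/-- Every plane of every tangent space has sectional curvature `c`. -/
def HasConstantCurvature (c : ℝ) : Prop :=
  ∀ (x : M) (u v : TangentSpace (𝓡 m) x), LinearIndependent ℝ ![u, v] →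
    sectionalCurvature m x u v = c

instance (x : M) : FiniteDimensional ℝ (TangentSpace (𝓡 m) x) :=
  inferInstanceAs (FiniteDimensional ℝ (EuclideanSpace ℝ (Fin m)))

/-- An orthonormal basis of the tangent space at `x`. -/
def tangentFrame (x : M) :
    OrthonormalBasis (Fin m) ℝ (TangentSpace (𝓡 m) x) :=
  (stdOrthonormalBasis ℝ (TangentSpace (𝓡 m) x)).reindex
    (finCongr ((LinearEquiv.refl ℝ (EuclideanSpace ℝ (Fin m))).finrank_eq.trans
      finrank_euclideanSpace_fin))

/-- The Ricci curvature `Ric(u, v) = ∑ ⟨R(e_i, u) v, e_i⟩`. -/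
def ricci (x : M) (u v : TangentSpace (𝓡 m) x) : ℝ :=
  ∑ i, riemannTensor m x (tangentFrame m x i) u v (tangentFrame m x i)

/-- The scalar curvature `τ = ∑_{i < j} K(e_i ∧ e_j)`. -/
def scalarCurvature (x : M) : ℝ :=
  ∑ i, ∑ j ∈ Finset.univ.filter (fun j => i < j),
    sectionalCurvature m x (tangentFrame m x i) (tangentFrame m x j)

/-- The normalized scalar curvature `ρ = 2τ / (m (m - 1))`. -/
def normalizedScalarCurvature (x : M) : ℝ :=
  2 * scalarCurvature m x / ((m : ℝ) * ((m : ℝ) - 1))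

variable (M) in
/-- `M` is Einstein: `Ric = μ g` for a constant `μ`. -/
def IsEinstein : Prop :=
  ∃ μ : ℝ, ∀ (x : M) (u v : TangentSpace (𝓡 m) x), ricci m x u v = μ * inner ℝ u v

end Intrinsic

/-! ### Submanifolds, given by isometric immersions -/

section Extrinsic

variable (n k : ℕ)
  {M : Type*} [TopologicalSpace M] [ChartedSpace (EuclideanSpace ℝ (Fin n)) M]
  [Bundle.RiemannianBundle (fun x : M => TangentSpace (𝓡 n) x)]
  {N : Type*} [TopologicalSpace N] [ChartedSpace (EuclideanSpace ℝ (Fin k)) N]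
  [Bundle.RiemannianBundle (fun x : N => TangentSpace (𝓡 k) x)]

/-- A smooth map which preserves the metrics (hence is an immersion): the metric of `M` is the one
induced by that of `N`. -/
structure IsIsometricImmersion (f : M → N) : Prop where
  contMDiff : ContMDiff (𝓡 n) (𝓡 k) ∞ f
  inner_mfderiv : ∀ (x : M) (u v : TangentSpace (𝓡 n) x),
    inner ℝ (mfderiv (𝓡 n) (𝓡 k) f x u) (mfderiv (𝓡 n) (𝓡 k) f x v) = inner ℝ u v

/-- The map `f` read in the charts at `x` and at `f x`. -/
def coordMap (f : M → N) (x : M) (y : EuclideanSpace ℝ (Fin n)) : EuclideanSpace ℝ (Fin k) :=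
  extChartAt (𝓡 k) (f x) (f ((extChartAt (𝓡 n) x).symm y))

/-- The second fundamental form `h(u, v) = ∇̄_u v - ∇_u v` in the charts at `x` and at `f x`,
the vector field `v` being extended with constant coordinates. For `F` the map `f` in charts,
`∇̄_u v = D_u (DF v) + Γ̄(DF u, DF v)` and `∇_u v = DF (Γ(u, v))`. -/
def coordSecondForm (f : M → N) (x : M) (u v : EuclideanSpace ℝ (Fin n)) :
    EuclideanSpace ℝ (Fin k) :=
  fderiv ℝ (fun y => fderiv ℝ (coordMap n k f x) y v) (extChartAt (𝓡 n) x x) u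
    + christoffel (chartMetric k (f x)) (extChartAt (𝓡 k) (f x) (f x))
        (fderiv ℝ (coordMap n k f x) (extChartAt (𝓡 n) x x) u)
        (fderiv ℝ (coordMap n k f x) (extChartAt (𝓡 n) x x) v)
    - fderiv ℝ (coordMap n k f x) (extChartAt (𝓡 n) x x)
        (christoffel (chartMetric n x) (extChartAt (𝓡 n) x x) u v)

/-- The squared length `‖h(u, v)‖²` of the second fundamental form on two tangent vectors,
that is `∑_r (h^r(u, v))²` over an orthonormal frame of the normal space. -/
def normSqSecondForm (f : M → N) (x : M) (u v : TangentSpace (𝓡 n) x) : ℝ :=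
  chartMetric k (f x) (extChartAt (𝓡 k) (f x) (f x))
    (coordSecondForm n k f x (toCoord n x u) (toCoord n x v))
    (coordSecondForm n k f x (toCoord n x u) (toCoord n x v))

/-- `f` is totally geodesic: its second fundamental form vanishes. -/
def IsTotallyGeodesic (f : M → N) : Prop :=
  ∀ (x : M) (u v : TangentSpace (𝓡 n) x),
    coordSecondForm n k f x (toCoord n x u) (toCoord n x v) = 0

/-- The Casorati curvature `𝒞 = (1/n) ∑_{i,j} ‖h(e_i, e_j)‖²` at `x`. -/
def casorati (f : M → N) (x : M) : ℝ :=
  1 / (n : ℝ) * ∑ i, ∑ j, normSqSecondForm n k f x (tangentFrame n x i) (tangentFrame n x j)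

/-- The Casorati curvature `𝒞(L) = (1/l) ∑_{i,j ≤ l} ‖h(e_i, e_j)‖²` of a subspace `L` of the
tangent space, where `l = dim L` and `e_1, …, e_l` is an orthonormal basis of `L`. -/
def casoratiSubspace (f : M → N) (x : M) (L : Submodule ℝ (TangentSpace (𝓡 n) x)) : ℝ :=
  1 / (Module.finrank ℝ L : ℝ) * ∑ i, ∑ j,
    normSqSecondForm n k f x (stdOrthonormalBasis ℝ L i) (stdOrthonormalBasis ℝ L j)

/-- The set of the Casorati curvatures of the hyperplanes of the tangent space at `x`. -/
def hyperplaneCasorati (f : M → N) (x : M) : Set ℝ :=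
  {a | ∃ L : Submodule ℝ (TangentSpace (𝓡 n) x),
    Module.finrank ℝ L + 1 = n ∧ casoratiSubspace n k f x L = a}

/-- The normalized δ-Casorati curvature
`δ̂_c(n-1) = 2 𝒞 - (2n-1)/(2n) sup 𝒞(L)`, with `L` over the hyperplanes. -/
def deltaHatCasorati (f : M → N) (x : M) : ℝ :=
  2 * casorati n k f x - (2 * (n : ℝ) - 1) / (2 * (n : ℝ)) * sSup (hyperplaneCasorati n k f x)

/-- The normalized δ-Casorati curvature
`δ_C(n-1) = ½ 𝒞 + (n+1)/(2n) inf 𝒞(L)`, with `L` over the hyperplanes. -/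
def deltaCasorati (f : M → N) (x : M) : ℝ :=
  1 / 2 * casorati n k f x + ((n : ℝ) + 1) / (2 * (n : ℝ)) * sInf (hyperplaneCasorati n k f x)

/-- Casorati ideal submanifold for `ρ ≤ δ̂_c(n-1) + c`: equality holds at every point. -/
def IsCasoratiIdealHat (c : ℝ) (f : M → N) : Prop :=
  ∀ x : M, normalizedScalarCurvature n x = deltaHatCasorati n k f x + c

/-- Casorati ideal submanifold for `ρ ≤ δ_C(n-1) + c`: equality holds at every point. -/
def IsCasoratiIdeal (c : ℝ) (f : M → N) : Prop :=
  ∀ x : M, normalizedScalarCurvature n x = deltaCasorati n k f x + c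

end Extrinsic

end Casorati

end

/-! Let `T` be the trace of the second fundamental form `h`, and let `S` and `P` be the total
squared norms of `h` over an orthonormal basis of the tangent space and of a hyperplane `L`. The
Gauss equation gives n(n-1)(ρ - c) = ‖T‖² - S. The values 𝒞(L) = P/(n-1) depend continuously on the
unit normal of `L`, so the supremum and infimum are attained. At such an `L`, each ideal condition
becomes ‖T‖² = αP + β(S - P), with (α, β) = ((2n-1)/2, 2n-1) in (a) and (n+1, (n+1)/2) in (b); both
pairs satisfy (n-1)/α + 1/β = 1.

By this relation between the weights, αP + β(S - P) - ‖T‖² is a sum of weighted squares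
(`weighted_defect`). Equality therefore forces `h` to be diagonal in a basis adapted to `L`, with
entries T/α along `L` and T/β on the normal.

The Ricci curvatures of these directions are then (n-1)c + (1/α - 1/α²)‖T‖² and (n-1)c + (1/β -
1/β²)‖T‖². The two coefficients agree only for n = 2, so the Einstein condition with n ≥ 3 gives T =
0, hence h = 0 (`eq_zero_of_ideal_of_einstein`). Conversely, h = 0 in the Gauss equation leaves Ric
= (n-1)c g.

The geometric input is `IsLocalIsometry.gauss`, proved in coordinates: the relation expressing that
∇ is the tangential part of the pulled-back ambient connection is differentiated once and
antisymmetrized. -/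

section

set_option maxSynthPendingDepth 3

noncomputable section

namespace Casorati

/-! ### Linear algebra of the equality case for a vector-valued symmetric form. -/

section BilinearForms

variable {V W X : Type*} [NormedAddCommGroup V] [InnerProductSpace ℝ V]
  [NormedAddCommGroup W] [InnerProductSpace ℝ W] [AddCommGroup X] [Module ℝ X]
  {ι κ : Type*} [Fintype ι] [Fintype κ]

/-- The trace of a bilinear map does not depend on the orthonormal basis. -/
lemma trace_bilin_eq (B : V →ₗ[ℝ] V →ₗ[ℝ] X) (b : OrthonormalBasis ι ℝ V)
    (b' : OrthonormalBasis κ ℝ V) : ∑ i, B (b i) (b i) = ∑ k, B (b' k) (b' k) := by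
  classical
  -- Both slots are expanded in `b'`; summing the coefficients over `i` then gives Kronecker deltas
  -- by Parseval.
  have h1 : ∀ i, B (b i) (b i) =
      ∑ k, ∑ l, (inner ℝ (b' k) (b i) * inner ℝ (b i) (b' l)) • B (b' k) (b' l) := by
    intro i
    conv_lhs => rw [← b'.sum_repr' (b i)]
    simp only [map_sum, LinearMap.sum_apply, map_smul, LinearMap.smul_apply, Finset.smul_sum,
      smul_smul]
    rw [Finset.sum_comm]
    refine Finset.sum_congr rfl fun k _ => Finset.sum_congr rfl fun l _ => ?_
    rw [real_inner_comm (b i) (b' l), mul_comm]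
  simp_rw [h1]
  rw [Finset.sum_comm]
  refine Finset.sum_congr rfl fun k _ => ?_
  rw [Finset.sum_comm]
  have h2 : ∀ l, ∑ i, (inner ℝ (b' k) (b i) * inner ℝ (b i) (b' l)) • B (b' k) (b' l)
      = (if k = l then (1 : ℝ) else 0) • B (b' k) (b' l) := by
    intro l
    rw [← Finset.sum_smul, b.sum_inner_mul_inner, orthonormal_iff_ite.1 b'.orthonormal]
  simp_rw [h2]
  simp

/-- The total squared norm of a bilinear map over a finite family of vectors. -/
def frameNormSq (h : V →ₗ[ℝ] V →ₗ[ℝ] W) (b : ι → V) : ℝ := ∑ i, ∑ j, ‖h (b i) (b j)‖ ^ 2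

/-- This is the trace of the form (x, y) ↦ ⟨h(u, x), h(u, y)⟩. -/
lemma sum_norm_sq_right_eq (h : V →ₗ[ℝ] V →ₗ[ℝ] W) (b : OrthonormalBasis ι ℝ V)
    (b' : OrthonormalBasis κ ℝ V) (u : V) : ∑ i, ‖h u (b i)‖ ^ 2 = ∑ k, ‖h u (b' k)‖ ^ 2 := by
  have := trace_bilin_eq (((innerₗ W).comp (h u)).compl₂ (h u)) b b'
  simpa using this

lemma sum_norm_sq_left_eq (h : V →ₗ[ℝ] V →ₗ[ℝ] W) (b : OrthonormalBasis ι ℝ V)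
    (b' : OrthonormalBasis κ ℝ V) (u : V) : ∑ i, ‖h (b i) u‖ ^ 2 = ∑ k, ‖h (b' k) u‖ ^ 2 :=
  sum_norm_sq_right_eq h.flip b b' u

/-- The basis is changed in one slot at a time, the other slot being held fixed. -/
lemma frameNormSq_eq (h : V →ₗ[ℝ] V →ₗ[ℝ] W) (b : OrthonormalBasis ι ℝ V)
    (b' : OrthonormalBasis κ ℝ V) : frameNormSq h b = frameNormSq h b' := by
  unfold frameNormSq
  simp_rw [fun i => sum_norm_sq_right_eq h b b' (b i)]
  rw [Finset.sum_comm]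
  simp_rw [fun k => sum_norm_sq_left_eq h b b' (b' k)]
  rw [Finset.sum_comm]

/-- In the applications `none` indexes the unit normal of a hyperplane and `some i` a basis of the
hyperplane. Symmetry merges the two mixed blocks, whence the factor 2. -/
lemma frameNormSq_option (h : V →ₗ[ℝ] V →ₗ[ℝ] W) (hs : ∀ u v, h u v = h v u) (b : Option ι → V) :
    frameNormSq h b = frameNormSq h (fun i => b (some i))
      + 2 * ∑ i, ‖h (b (some i)) (b none)‖ ^ 2 + ‖h (b none) (b none)‖ ^ 2 := by
  simp only [frameNormSq, Fintype.sum_option, Finset.sum_add_distrib, hs (b none)]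
  ring

/-- A weighted Cauchy-Schwarz defect: if `card ι / α + 1 / β = 1`, then
`α ∑ ‖w i‖² + β ‖k‖² - ‖∑ w i + k‖²` is a sum of weighted squares. -/
lemma weighted_defect (w : ι → W) (k : W) {α β : ℝ} (hα : 0 < α) (hβ : 0 < β)
    (hαβ : Fintype.card ι / α + 1 / β = 1) (T : W) (hT : T = k + ∑ i, w i) :
    α * ∑ i, ‖w i‖ ^ 2 + β * ‖k‖ ^ 2 - ‖T‖ ^ 2 =
      α * ∑ i, ‖w i - (1 / α) • T‖ ^ 2 + β * ‖k - (1 / β) • T‖ ^ 2 := by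
  have e : ∀ x : W, ∀ t : ℝ, ‖x - t • T‖ ^ 2 = ‖x‖ ^ 2 - 2 * t * inner ℝ x T + t ^ 2 * ‖T‖ ^ 2 := by
    intro x t
    rw [norm_sub_sq_real, inner_smul_right, norm_smul, mul_pow, Real.norm_eq_abs, sq_abs]
    ring
  simp_rw [e]
  have h1 : ‖T‖ ^ 2 = inner ℝ k T + ∑ i, inner ℝ (w i) T := by
    rw [← real_inner_self_eq_norm_sq, ← sum_inner, ← inner_add_left, ← hT]
  rw [Finset.sum_add_distrib, Finset.sum_sub_distrib, ← Finset.mul_sum, Finset.sum_const,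
    Finset.card_univ, nsmul_eq_mul]
  have h2 : ∑ i, inner ℝ (w i) T = ‖T‖ ^ 2 - inner ℝ k T := by linarith
  rw [h2]
  -- The weight relation solved for the cardinality: after expansion ‖T‖² carries the coefficient
  -- card ι / α + 1 / β - 2 = -1.
  have h3 : (Fintype.card ι : ℝ) = α * (1 - 1 / β) := by
    field_simp at hαβ ⊢; linarith
  rw [h3]
  field_simp
  ring

variable [DecidableEq ι]

/-- If the weighted inequality is an equality and the Ricci form of `h` is a multiple of the
metric, then `h = 0`. -/
theorem eq_zero_of_ideal_of_einstein [Nonempty ι] (h : V →ₗ[ℝ] V →ₗ[ℝ] W)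
    (hs : ∀ u v, h u v = h v u) (b : OrthonormalBasis (Option ι) ℝ V) {α β : ℝ} (hα : 0 < α)
    (hβ : 0 < β) (hαβ : Fintype.card ι / α + 1 / β = 1)
    (hne : 1 / α - (1 / α) ^ 2 ≠ 1 / β - (1 / β) ^ 2)
    (hideal : ‖∑ i, h (b i) (b i)‖ ^ 2 = α * frameNormSq h (fun i => b (some i))
      + β * (2 * ∑ i, ‖h (b (some i)) (b none)‖ ^ 2 + ‖h (b none) (b none)‖ ^ 2))
    {μ : ℝ} (hE : ∀ u, inner ℝ (h u u) (∑ i, h (b i) (b i)) - ∑ i, ‖h (b i) u‖ ^ 2 = μ * ‖u‖ ^ 2) :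
    h = 0 := by
  set T := ∑ i, h (b i) (b i) with hT
  have hT' : T = h (b none) (b none) + ∑ i, h (b (some i)) (b (some i)) := by
    rw [hT, Fintype.sum_option]
  have hdef := weighted_defect (fun i => h (b (some i)) (b (some i))) (h (b none) (b none)) hα hβ
    hαβ T hT'
  have hsplit : frameNormSq h (fun i => b (some i)) =
      ∑ i, ‖h (b (some i)) (b (some i))‖ ^ 2
        + ∑ i, ∑ j ∈ Finset.univ.erase i, ‖h (b (some i)) (b (some j))‖ ^ 2 := by
    rw [frameNormSq, ← Finset.sum_add_distrib]
    exact Finset.sum_congr rfl fun i _ => (Finset.add_sum_erase _ _ (Finset.mem_univ i)).symm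
  have p1 : 0 ≤ ∑ i, ‖h (b (some i)) (b (some i)) - (1 / α) • T‖ ^ 2 := by positivity
  have p2 : 0 ≤ ‖h (b none) (b none) - (1 / β) • T‖ ^ 2 := by positivity
  have p3 : 0 ≤ ∑ i, ∑ j ∈ Finset.univ.erase i, ‖h (b (some i)) (b (some j))‖ ^ 2 := by positivity
  have p4 : 0 ≤ ∑ i, ‖h (b (some i)) (b none)‖ ^ 2 := by positivity
  rw [hsplit] at hideal
  have q1 := mul_nonneg hα.le p1
  have q2 := mul_nonneg hβ.le p2
  have q3 := mul_nonneg hα.le p3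
  have q4 := mul_nonneg hβ.le p4
  -- Combined with `hdef`, the equality `hideal` says that four nonnegative terms add up to zero:
  -- the two defects, the off-diagonal part on the hyperplane and the mixed part.
  have z1 : ∑ i, ‖h (b (some i)) (b (some i)) - (1 / α) • T‖ ^ 2 = 0 :=
    (mul_eq_zero.1 (by linarith :
      α * ∑ i, ‖h (b (some i)) (b (some i)) - (1 / α) • T‖ ^ 2 = 0)).resolve_left hα.ne'
  have z2 : ‖h (b none) (b none) - (1 / β) • T‖ ^ 2 = 0 :=
    (mul_eq_zero.1 (by linarith :
      β * ‖h (b none) (b none) - (1 / β) • T‖ ^ 2 = 0)).resolve_left hβ.ne'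
  have z3 : ∑ i, ∑ j ∈ Finset.univ.erase i, ‖h (b (some i)) (b (some j))‖ ^ 2 = 0 :=
    (mul_eq_zero.1 (by linarith : α * ∑ i, ∑ j ∈ Finset.univ.erase i,
      ‖h (b (some i)) (b (some j))‖ ^ 2 = 0)).resolve_left hα.ne'
  have z4 : ∑ i, ‖h (b (some i)) (b none)‖ ^ 2 = 0 :=
    (mul_eq_zero.1 (by linarith :
      β * ∑ i, ‖h (b (some i)) (b none)‖ ^ 2 = 0)).resolve_left hβ.ne'
  have w1 : ∀ i, h (b (some i)) (b (some i)) = (1 / α) • T := by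
    intro i
    have := (Finset.sum_eq_zero_iff_of_nonneg (fun _ _ => by positivity)).1 z1 i (Finset.mem_univ i)
    simpa [sub_eq_zero] using this
  have w2 : h (b none) (b none) = (1 / β) • T := by simpa [sub_eq_zero] using z2
  have w3 : ∀ i j, j ≠ i → h (b (some i)) (b (some j)) = 0 := by
    intro i j hij
    have := (Finset.sum_eq_zero_iff_of_nonneg (fun _ _ => by positivity)).1 z3 i (Finset.mem_univ i)
    have := (Finset.sum_eq_zero_iff_of_nonneg (fun _ _ => by positivity)).1 this j (by simp [hij])
    simpa using this
  have w4 : ∀ i, h (b (some i)) (b none) = 0 := by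
    intro i
    have := (Finset.sum_eq_zero_iff_of_nonneg (fun _ _ => by positivity)).1 z4 i (Finset.mem_univ i)
    simpa using this
  have nsq : ∀ t : ℝ, inner ℝ (t • T) T - ‖t • T‖ ^ 2 = (t - t ^ 2) * ‖T‖ ^ 2 := by
    intro t
    rw [inner_smul_left, real_inner_self_eq_norm_sq, norm_smul, mul_pow, Real.norm_eq_abs, sq_abs]
    simp; ring
  obtain ⟨i₀⟩ := ‹Nonempty ι›
  -- The Ricci form is evaluated on a hyperplane vector and on the normal. Since `h` is diagonal,
  -- only one term of each sum survives, and comparing the two values isolates ‖T‖².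
  have r1 := hE (b (some i₀))
  rw [Fintype.sum_option, hs (b none), w4, Finset.sum_eq_single i₀
    (fun j _ hj => by rw [w3 j i₀ hj.symm]; simp) (by simp), w1, b.norm_eq_one] at r1
  have r2 := hE (b none)
  rw [Fintype.sum_option, Finset.sum_eq_zero (fun i _ => by rw [w4]; simp), w2,
    b.norm_eq_one] at r2
  have hT0 : T = 0 := by
    have k1 := nsq (1 / α)
    have k2 := nsq (1 / β)
    have : (1 / α - (1 / α) ^ 2 - (1 / β - (1 / β) ^ 2)) * ‖T‖ ^ 2 = 0 := by
      rw [norm_zero] at r1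
      linarith
    simpa using (mul_eq_zero.1 this).resolve_left (sub_ne_zero.2 hne)
  rw [hT0, smul_zero] at w2
  simp only [hT0, smul_zero] at w1
  refine b.toBasis.ext fun i => b.toBasis.ext fun j => ?_
  simp only [OrthonormalBasis.coe_toBasis, LinearMap.zero_apply]
  rcases i with _ | i <;> rcases j with _ | j
  · exact w2
  · rw [hs, w4]
  · exact w4 i
  · by_cases hij : j = i
    · subst hij; exact w1 j
    · exact w3 i j hij

end BilinearForms

/-! ### Hyperplanes and attainment of the extremal Casorati values. -/

section Hyperplanes

variable {V W : Type*} [NormedAddCommGroup V] [InnerProductSpace ℝ V] [FiniteDimensional ℝ V]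
  [NormedAddCommGroup W] [InnerProductSpace ℝ W]

/-- An orthonormal basis of a hyperplane, completed by a unit normal vector. -/
lemma exists_basis_extending_hyperplane (L : Submodule ℝ V)
    (hL : Module.finrank ℝ L + 1 = Module.finrank ℝ V) {ξ : V} (hξ : ξ ∈ Lᗮ) (hξ1 : ‖ξ‖ = 1) :
    ∃ b : OrthonormalBasis (Option (Fin (Module.finrank ℝ L))) ℝ V,
      b none = ξ ∧ ∀ i, b (some i) = stdOrthonormalBasis ℝ L i := by
  let v : Option (Fin (Module.finrank ℝ L)) → V := fun o => o.elim ξ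
    fun i => (stdOrthonormalBasis ℝ L i : V)
  have hon : Orthonormal ℝ v := by
    rw [orthonormal_iff_ite]
    have hb := orthonormal_iff_ite.1 (stdOrthonormalBasis ℝ L).orthonormal
    rintro (_ | i) (_ | j)
    · simp [v, hξ1]
    · simpa [v] using (Submodule.mem_orthogonal' _ _).1 hξ _ (stdOrthonormalBasis ℝ L j).2
    · simpa [v] using (Submodule.mem_orthogonal _ _).1 hξ _ (stdOrthonormalBasis ℝ L i).2
    · simpa [v] using hb i j
  have hcard : Fintype.card (Option (Fin (Module.finrank ℝ L))) = Module.finrank ℝ V := by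
    simpa using hL
  let B := basisOfOrthonormalOfCardEqFinrank hon hcard
  have hB : ⇑B = v := coe_basisOfOrthonormalOfCardEqFinrank hon hcard
  refine ⟨B.toOrthonormalBasis (by rw [hB]; exact hon), ?_, fun i => ?_⟩
  · rw [Module.Basis.coe_toOrthonormalBasis, hB]; rfl
  · rw [Module.Basis.coe_toOrthonormalBasis, hB]; rfl

lemma exists_unit_normal (L : Submodule ℝ V)
    (hL : Module.finrank ℝ L + 1 = Module.finrank ℝ V) : ∃ ξ ∈ Lᗮ, ‖ξ‖ = 1 := by
  have h1 : Module.finrank ℝ Lᗮ = 1 := by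
    have := L.finrank_add_finrank_orthogonal
    omega
  have : Nontrivial Lᗮ := Module.nontrivial_of_finrank_pos (R := ℝ) (by omega)
  obtain ⟨x, hx⟩ := exists_norm_eq Lᗮ (zero_le_one (α := ℝ))
  exact ⟨x, x.2, by simpa using hx⟩

/-- The normalized squared norms of `h` on the hyperplanes of `V`. -/
def hyperplaneValues (h : V →ₗ[ℝ] V →ₗ[ℝ] W) : Set ℝ :=
  {a | ∃ L : Submodule ℝ V, Module.finrank ℝ L + 1 = Module.finrank ℝ V ∧
    1 / (Module.finrank ℝ L : ℝ) *
      frameNormSq h (fun i => (stdOrthonormalBasis ℝ L i : V)) = a}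

/-- Inclusion-exclusion: the two mixed sums over a full basis both contain the ξξ term, which is
added back once. The right side uses a basis `e` independent of `L`, so it is visibly a function of
the normal alone. -/
lemma frameNormSq_hyperplane (h : V →ₗ[ℝ] V →ₗ[ℝ] W) (hs : ∀ u v, h u v = h v u)
    (L : Submodule ℝ V) (hL : Module.finrank ℝ L + 1 = Module.finrank ℝ V) {ξ : V} (hξ : ξ ∈ Lᗮ)
    (hξ1 : ‖ξ‖ = 1) {ι : Type*} [Fintype ι] (e : OrthonormalBasis ι ℝ V) :
    frameNormSq h (fun i => (stdOrthonormalBasis ℝ L i : V)) =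
      frameNormSq h e - 2 * ∑ i, ‖h (e i) ξ‖ ^ 2 + ‖h ξ ξ‖ ^ 2 := by
  obtain ⟨b, hb, hb'⟩ := exists_basis_extending_hyperplane L hL hξ hξ1
  rw [frameNormSq_eq h e b, sum_norm_sq_left_eq h e b, frameNormSq_option h hs,
    Fintype.sum_option, hb]
  simp only [hb']
  ring

/-- The set is the image of the unit sphere of normals under a continuous function. Compactness is
what turns a supremum or infimum into the value at an actual hyperplane. -/
lemma isCompact_hyperplaneValues (h : V →ₗ[ℝ] V →ₗ[ℝ] W) (hs : ∀ u v, h u v = h v u) :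
    IsCompact (hyperplaneValues h) := by
  let e := stdOrthonormalBasis ℝ V
  -- The truncated subtraction is harmless: for a hyperplane `L` the factor is the dimension of `L`.
  let A : V → ℝ := fun ξ => 1 / ((Module.finrank ℝ V - 1 : ℕ) : ℝ) *
    (frameNormSq h e - 2 * ∑ i, ‖h (e i) ξ‖ ^ 2 + ‖h ξ ξ‖ ^ 2)
  have hcont : Continuous A := by
    have h1 : ∀ u, Continuous fun ξ => h u ξ := fun u =>
      (h u).continuous_of_finiteDimensional
    have h2 : Continuous fun ξ => h ξ ξ := by
      -- Expanding one slot in a basis reduces continuity on the diagonal to that of linear maps in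
      -- finite dimension.
      have : (fun ξ => h ξ ξ) = fun ξ => ∑ i, (inner ℝ (e i) ξ : ℝ) • h (e i) ξ := by
        ext ξ
        conv_lhs => rw [show h ξ = h (∑ i, inner ℝ (e i) ξ • e i) by rw [e.sum_repr']]
        simp
      rw [this]
      exact continuous_finsetSum _ fun i _ => (by fun_prop : Continuous
        fun ξ => (inner ℝ (e i) ξ : ℝ)).smul (h1 _)
    have h3 : Continuous fun ξ => ∑ i, ‖h (e i) ξ‖ ^ 2 :=
      continuous_finsetSum _ fun i _ => ((h1 _).norm.pow 2)
    exact continuous_const.mul ((continuous_const.sub (continuous_const.mul h3)).add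
      (h2.norm.pow 2))
  have heq : hyperplaneValues h = A '' Metric.sphere 0 1 := by
    ext a
    constructor
    · rintro ⟨L, hL, rfl⟩
      obtain ⟨ξ, hξ, hξ1⟩ := exists_unit_normal L hL
      refine ⟨ξ, by simpa using hξ1, ?_⟩
      rw [frameNormSq_hyperplane h hs L hL hξ hξ1 e]
      simp only [A, ← hL, Nat.add_sub_cancel]
    · rintro ⟨ξ, hξ, rfl⟩
      have hξ1 : ‖ξ‖ = 1 := by simpa using hξ
      have hξ0 : ξ ≠ 0 := by rintro rfl; simp at hξ1
      have hL : Module.finrank ℝ (ℝ ∙ ξ)ᗮ + 1 = Module.finrank ℝ V := by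
        have := (ℝ ∙ ξ).finrank_add_finrank_orthogonal
        rw [finrank_span_singleton hξ0] at this
        omega
      refine ⟨(ℝ ∙ ξ)ᗮ, hL, ?_⟩
      rw [frameNormSq_hyperplane h hs _ hL (ξ := ξ) ?_ hξ1 e]
      · simp only [A, ← hL, Nat.add_sub_cancel]
      · exact Submodule.le_orthogonal_orthogonal _ (Submodule.mem_span_singleton_self ξ)
  rw [heq]
  exact (isCompact_sphere 0 1).image hcont

lemma hyperplaneValues_nonempty [Nontrivial V] (h : V →ₗ[ℝ] V →ₗ[ℝ] W) :
    (hyperplaneValues h).Nonempty := by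
  obtain ⟨ξ, hξ⟩ := exists_ne (0 : V)
  refine ⟨_, (ℝ ∙ ξ)ᗮ, ?_, rfl⟩
  have := (ℝ ∙ ξ).finrank_add_finrank_orthogonal
  rw [finrank_span_singleton hξ] at this
  omega

lemma two_mul_sum_lt {n : ℕ} (g : Fin n → Fin n → ℝ) (hg : ∀ i j, g i j = g j i)
    (hg0 : ∀ i, g i i = 0) :
    2 * ∑ i, ∑ j ∈ Finset.univ.filter (fun j => i < j), g i j = ∑ i, ∑ j, g i j := by
  have e : ∀ i j, g i j = (if i < j then g i j else 0) + (if j < i then g j i else 0) := by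
    intro i j
    rcases lt_trichotomy i j with hij | rfl | hij
    · simp [hij, hij.not_gt]
    · simp [hg0]
    · simp [hij, hij.not_gt, hg i j]
  have r : ∑ i, ∑ j, g i j = (∑ i, ∑ j, if i < j then g i j else 0)
      + ∑ i, ∑ j, if j < i then g j i else 0 := by
    simp_rw [← Finset.sum_add_distrib]
    exact Finset.sum_congr rfl fun i _ => Finset.sum_congr rfl fun j _ => e i j
  rw [r, Finset.sum_comm (f := fun i j => if j < i then g j i else 0)]
  simp_rw [Finset.sum_filter]
  ring

end Hyperplanes

/-! ### Levi-Civita calculus in coordinates and the Gauss equation. -/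

section CoordinateCalculus

variable {E E' : Type*} [NormedAddCommGroup E] [NormedSpace ℝ E] [NormedAddCommGroup E']
  [NormedSpace ℝ E']

/-- `G` is a smooth Riemannian metric on the open subset `U` of a normed space. -/
structure IsLocalMetric (G : E → E →L[ℝ] E →L[ℝ] ℝ) (U : Set E) : Prop where
  isOpen : IsOpen U
  contDiffOn : ContDiffOn ℝ ∞ G U
  symm : ∀ y ∈ U, ∀ u v, G y u v = G y v u
  pos : ∀ y ∈ U, ∀ v, v ≠ 0 → 0 < G y v v

/-- `christoffelLow` as a bundled bilinear map. -/
def christoffelLowL (G : E → E →L[ℝ] E →L[ℝ] ℝ) (y : E) : E →L[ℝ] E →L[ℝ] E →L[ℝ] ℝ :=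
  (1 / 2 : ℝ) • (fderiv ℝ G y + (fderiv ℝ G y).flip -
    (ContinuousLinearMap.flipₗᵢ ℝ E E ℝ).toContinuousLinearEquiv.toContinuousLinearMap.comp
      (fderiv ℝ G y).flip)

/-- `christoffel` as a bundled bilinear map. -/
def christoffelL (G : E → E →L[ℝ] E →L[ℝ] ℝ) (y : E) : E →L[ℝ] E →L[ℝ] E :=
  (ContinuousLinearMap.compL ℝ E (E →L[ℝ] ℝ) E (G y).inverse).comp (christoffelLowL G y)

lemma christoffelL_apply (G : E → E →L[ℝ] E →L[ℝ] ℝ) (y u v : E) :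
    christoffelL G y u v = christoffel G y u v := by
  simp [christoffelL, christoffel, christoffelLowL, christoffelLow]

lemma christoffelLow_apply (G : E → E →L[ℝ] E →L[ℝ] ℝ) (y u v w : E) :
    christoffelLow G y u v w =
      1 / 2 * (fderiv ℝ G y u v w + fderiv ℝ G y v u w - fderiv ℝ G y w u v) := by
  simp [christoffelLow]

/-- The product rule for the metric along a map. -/
lemma fderiv_metric_along {G : E' → E' →L[ℝ] E' →L[ℝ] ℝ} {F X Y : E → E'} {y : E}
    (hG : DifferentiableAt ℝ G (F y)) (hF : DifferentiableAt ℝ F y)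
    (hX : DifferentiableAt ℝ X y) (hY : DifferentiableAt ℝ Y y) (u : E) :
    fderiv ℝ (fun z => G (F z) (X z) (Y z)) y u =
      fderiv ℝ G (F y) (fderiv ℝ F y u) (X y) (Y y) + G (F y) (fderiv ℝ X y u) (Y y)
        + G (F y) (X y) (fderiv ℝ Y y u) := by
  have h1 := ((hG.hasFDerivAt.comp y hF.hasFDerivAt).clm_apply hX.hasFDerivAt).clm_apply
    hY.hasFDerivAt
  have h2 : fderiv ℝ (fun z => G (F z) (X z) (Y z)) y = _ := h1.fderiv
  rw [h2]
  simp
  ring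

lemma fderiv_apply_const {A : E → E →L[ℝ] E'} {y : E} (hA : DifferentiableAt ℝ A y) (u v : E) :
    fderiv ℝ (fun z => A z v) y u = fderiv ℝ A y u v := by
  have h : fderiv ℝ (fun z => A z v) y = _ :=
    (hA.hasFDerivAt.clm_apply (hasFDerivAt_const v y)).fderiv
  rw [h]; simp

lemma fderiv_apply_const₂ {A : E → E →L[ℝ] E →L[ℝ] E'} {y : E} (hA : DifferentiableAt ℝ A y)
    (u v w : E) : fderiv ℝ (fun z => A z v w) y u = fderiv ℝ A y u v w := by
  have hAv : DifferentiableAt ℝ (fun z => A z v) y := hA.clm_apply (differentiableAt_const v)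
  rw [fderiv_apply_const hAv, fderiv_apply_const hA]

lemma snd_fderiv_symm {F : E → E'} {y : E} (hF : ContDiffAt ℝ ∞ F y) (u v : E) :
    fderiv ℝ (fderiv ℝ F) y u v = fderiv ℝ (fderiv ℝ F) y v u :=
  (hF.isSymmSndFDerivAt (by simpa using ENat.LEInfty.out)).eq u v

namespace IsLocalMetric

variable {G : E → E →L[ℝ] E →L[ℝ] ℝ} {U : Set E} (hG : IsLocalMetric G U)
include hG

lemma mono {U₀ : Set E} (hU₀ : IsOpen U₀) (hsub : U₀ ⊆ U) : IsLocalMetric G U₀ where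
  isOpen := hU₀
  contDiffOn := hG.contDiffOn.mono hsub
  symm y hy := hG.symm y (hsub hy)
  pos y hy := hG.pos y (hsub hy)

lemma contDiffAt {y : E} (hy : y ∈ U) : ContDiffAt ℝ ∞ G y :=
  hG.contDiffOn.contDiffAt (hG.isOpen.mem_nhds hy)

lemma differentiableAt {y : E} (hy : y ∈ U) : DifferentiableAt ℝ G y :=
  (hG.contDiffAt hy).differentiableAt (by simp)

lemma mem_nhds {y : E} (hy : y ∈ U) : U ∈ nhds y := hG.isOpen.mem_nhds hy

lemma fderiv_symm {y : E} (hy : y ∈ U) (u v w : E) :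
    fderiv ℝ G y u v w = fderiv ℝ G y u w v := by
  rw [← fderiv_apply_const₂ (hG.differentiableAt hy),
    ← fderiv_apply_const₂ (hG.differentiableAt hy)]
  have : (fun z => G z v w) =ᶠ[nhds y] fun z => G z w v := by
    filter_upwards [hG.mem_nhds hy] with z hz using hG.symm z hz v w
  rw [this.fderiv_eq]

lemma christoffel_symm {y : E} (hy : y ∈ U) (u v : E) :
    christoffel G y u v = christoffel G y v u := by
  unfold christoffel
  congr 1
  ext w
  rw [christoffelLow_apply, christoffelLow_apply, hG.fderiv_symm hy w u v]
  ring

variable [FiniteDimensional ℝ E]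

/-- Positivity makes `G y` injective, and the dual has the same dimension. Hence `inverse` in
`christoffel` is a genuine inverse and not its default value 0. -/
lemma isInvertible {y : E} (hy : y ∈ U) : (G y).IsInvertible := by
  have hinj : Function.Injective (G y) := by
    rw [injective_iff_map_eq_zero]
    intro v hv
    by_contra h
    have := hG.pos y hy v h
    simp [hv] at this
  have hfin : Module.finrank ℝ E = Module.finrank ℝ (E →L[ℝ] ℝ) := by
    rw [← (LinearMap.toContinuousLinearMap (𝕜 := ℝ) (E := E) (F' := ℝ)).finrank_eq]
    exact (Subspace.dual_finrank_eq (K := ℝ) (V := E)).symm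
  refine ⟨(LinearEquiv.ofInjectiveOfFinrankEq (G y : E →ₗ[ℝ] E →L[ℝ] ℝ)
    hinj hfin).toContinuousLinearEquiv, ?_⟩
  ext v w
  rfl

lemma apply_christoffel {y : E} (hy : y ∈ U) (u v w : E) :
    G y (christoffel G y u v) w =
      1 / 2 * (fderiv ℝ G y u v w + fderiv ℝ G y v u w - fderiv ℝ G y w u v) := by
  obtain ⟨e, he⟩ := hG.isInvertible hy
  rw [← christoffelLow_apply, christoffel, ← he, ContinuousLinearMap.inverse_equiv]
  simp

/-- The metric is parallel: in the sum of the two Koszul expressions the derivatives in directions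
`v` and `w` cancel. -/
lemma compat {y : E} (hy : y ∈ U) (u v w : E) :
    fderiv ℝ G y u v w = G y (christoffel G y u v) w + G y v (christoffel G y u w) := by
  rw [hG.symm y hy v, hG.apply_christoffel hy, hG.apply_christoffel hy,
    hG.fderiv_symm hy w u v, hG.fderiv_symm hy u w v, hG.fderiv_symm hy v u w]
  ring

set_option synthInstance.maxHeartbeats 100000 in
lemma contDiffAt_christoffelL {y : E} (hy : y ∈ U) : ContDiffAt ℝ ∞ (christoffelL G) y := by
  have h1 : ContDiffAt ℝ ∞ (fderiv ℝ G) y := (hG.contDiffAt hy).fderiv_right (by simp)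
  have hfl : ContDiffAt ℝ ∞ (fun z => (fderiv ℝ G z).flip) y :=
    (ContinuousLinearMap.flipₗᵢ ℝ E E (E →L[ℝ] ℝ)).toContinuousLinearEquiv.contDiff.contDiffAt.comp
      y h1
  have h2 : ContDiffAt ℝ ∞ (christoffelLowL G) y := by
    unfold christoffelLowL
    exact ((h1.add hfl).sub (contDiffAt_const.clm_comp hfl)).const_smul _
  have h3 : ContDiffAt ℝ ∞ (fun z => (G z).inverse) y :=
    ((hG.isInvertible hy).contDiffAt_map_inverse).comp y (hG.contDiffAt hy)
  unfold christoffelL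
  exact ((ContinuousLinearMap.compL ℝ E (E →L[ℝ] ℝ) E).contDiff.contDiffAt.comp y h3).clm_comp h2

lemma differentiableAt_christoffelL {y : E} (hy : y ∈ U) :
    DifferentiableAt ℝ (christoffelL G) y :=
  (hG.contDiffAt_christoffelL hy).differentiableAt (by simp)

lemma fderiv_christoffel {y : E} (hy : y ∈ U) (u v w : E) :
    fderiv ℝ (fun z => christoffel G z v w) y u = fderiv ℝ (christoffelL G) y u v w := by
  simp_rw [← christoffelL_apply]
  exact fderiv_apply_const₂ (hG.differentiableAt_christoffelL hy) u v w

lemma differentiableAt_christoffel {y : E} (hy : y ∈ U) (v w : E) :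
    DifferentiableAt ℝ (fun z => christoffel G z v w) y := by
  simp_rw [← christoffelL_apply]
  exact ((hG.differentiableAt_christoffelL hy).clm_apply (differentiableAt_const v)).clm_apply
    (differentiableAt_const w)

lemma coordCurvature_eq {y : E} (hy : y ∈ U) (u v w : E) :
    coordCurvature G y u v w =
      fderiv ℝ (christoffelL G) y u v w - fderiv ℝ (christoffelL G) y v u w
        + christoffelL G y u (christoffelL G y v w)
        - christoffelL G y v (christoffelL G y u w) := by
  rw [coordCurvature, hG.fderiv_christoffel hy, hG.fderiv_christoffel hy]
  simp only [christoffelL_apply]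

omit hG [FiniteDimensional ℝ E] in
lemma _root_.Casorati.coordCurvature_antisymm {y : E} (u v w : E) :
    coordCurvature G y v u w = - coordCurvature G y u v w := by
  simp only [coordCurvature]
  abel

-- Torsion-freeness near `y` makes both the derivative terms and the quadratic terms cancel in the
-- cyclic sum.
omit [FiniteDimensional ℝ E] in
lemma bianchi {y : E} (hy : y ∈ U) (u v w : E) :
    coordCurvature G y u v w + coordCurvature G y v w u + coordCurvature G y w u v = 0 := by
  have hs : ∀ a b, (fun z => christoffel G z a b) =ᶠ[nhds y] fun z => christoffel G z b a := by
    intro a b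
    filter_upwards [hG.mem_nhds hy] with z hz using hG.christoffel_symm hz a b
  simp only [coordCurvature]
  rw [(hs v w).fderiv_eq, (hs w u).fderiv_eq, (hs u v).fderiv_eq, hG.christoffel_symm hy v w,
    hG.christoffel_symm hy w u, hG.christoffel_symm hy u v]
  abel

end IsLocalMetric

section Along

variable {G' : E' → E' →L[ℝ] E' →L[ℝ] ℝ} {U' : Set E'} [FiniteDimensional ℝ E']

/-- Metric compatibility of the Levi-Civita derivative along a map. -/
lemma IsLocalMetric.fderiv_along (hG' : IsLocalMetric G' U') {F X Y : E → E'} {y : E}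
    (hy : F y ∈ U') (hF : DifferentiableAt ℝ F y)
    (hX : DifferentiableAt ℝ X y) (hY : DifferentiableAt ℝ Y y) (u : E) :
    fderiv ℝ (fun z => G' (F z) (X z) (Y z)) y u =
      G' (F y) (fderiv ℝ X y u + christoffel G' (F y) (fderiv ℝ F y u) (X y)) (Y y)
        + G' (F y) (X y) (fderiv ℝ Y y u + christoffel G' (F y) (fderiv ℝ F y u) (Y y)) := by
  rw [fderiv_metric_along (hG'.differentiableAt hy) hF hX hY, hG'.compat hy]
  simp only [map_add, add_apply]
  ring

end Along

namespace IsLocalMetric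

variable {G : E → E →L[ℝ] E →L[ℝ] ℝ} {U : Set E} [FiniteDimensional ℝ E] (hG : IsLocalMetric G U)
include hG

/-- The derivative of `G(Γ(v, w), z)` in direction `u`. -/
lemma fderiv_apply_christoffel {y : E} (hy : y ∈ U) (u v w z : E) :
    fderiv ℝ (fun x => G x (christoffel G x v w) z) y u =
      G y (fderiv ℝ (fun x => christoffel G x v w) y u
        + christoffel G y u (christoffel G y v w)) z
        + G y (christoffel G y v w) (christoffel G y u z) := by
  have := hG.fderiv_along (F := fun x => x) (X := fun x => christoffel G x v w)
    (Y := fun _ => z) hy differentiableAt_id (hG.differentiableAt_christoffel hy v w)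
    (differentiableAt_const z) u
  simpa using this

/-- Differentiating `compat` once more expresses D²G through Γ and its derivative; the symmetry of
D²G in `u`, `v` is the claim once the mixed products cancel. -/
lemma curvature_skew {y : E} (hy : y ∈ U) (u v w z : E) :
    G y (coordCurvature G y u v w) z = - G y (coordCurvature G y u v z) w := by
  have hev : ∀ a, (fun x => fderiv ℝ G x a w z) =ᶠ[nhds y]
      fun x => G x (christoffel G x a w) z + G x (christoffel G x a z) w := by
    intro a
    filter_upwards [hG.mem_nhds hy] with x hx
    rw [hG.compat hx, hG.symm x hx w]
  have hd : ∀ a b c, DifferentiableAt ℝ (fun x => G x (christoffel G x a b) c) y := fun a b c =>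
    ((hG.differentiableAt hy).clm_apply (hG.differentiableAt_christoffel hy a b)).clm_apply
      (differentiableAt_const c)
  have hDG : DifferentiableAt ℝ (fderiv ℝ G) y :=
    ((hG.contDiffAt hy).fderiv_right (m := ∞) (by simp)).differentiableAt (by simp)
  have key : ∀ a b, fderiv ℝ (fderiv ℝ G) y b a w z =
      G y (fderiv ℝ (fun x => christoffel G x a w) y b
        + christoffel G y b (christoffel G y a w)) z
        + G y (christoffel G y a w) (christoffel G y b z)
      + (G y (fderiv ℝ (fun x => christoffel G x a z) y b
        + christoffel G y b (christoffel G y a z)) w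
        + G y (christoffel G y a z) (christoffel G y b w)) := by
    intro a b
    have hDGa : DifferentiableAt ℝ (fun x => fderiv ℝ G x a) y :=
      hDG.clm_apply (differentiableAt_const a)
    have h1 : fderiv ℝ (fun x => fderiv ℝ G x a w z) y b = fderiv ℝ (fderiv ℝ G) y b a w z := by
      rw [fderiv_apply_const₂ hDGa, fderiv_apply_const hDG]
    rw [← h1, (hev a).fderiv_eq, fderiv_fun_add (hd _ _ _) (hd _ _ _),
      add_apply, hG.fderiv_apply_christoffel hy,
      hG.fderiv_apply_christoffel hy]
  have hsym := snd_fderiv_symm (hG.contDiffAt hy) u v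
  have hsym' : fderiv ℝ (fderiv ℝ G) y u v w z = fderiv ℝ (fderiv ℝ G) y v u w z := by rw [hsym]
  rw [key, key, hG.symm y hy (christoffel G y v w), hG.symm y hy (christoffel G y v z)] at hsym'
  simp only [coordCurvature, map_add, map_sub, add_apply,
    sub_apply] at hsym' ⊢
  linarith

/-- The classical argument: a linear combination of four Bianchi identities, using skewness in each
pair. -/
lemma curvature_pair_symm {y : E} (hy : y ∈ U) (a b c d : E) :
    G y (coordCurvature G y a b c) d = G y (coordCurvature G y c d a) b := by
  have B : ∀ u v w z, G y (coordCurvature G y u v w) z + G y (coordCurvature G y v w u) z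
      + G y (coordCurvature G y w u v) z = 0 := by
    intro u v w z
    have := congrArg (fun x => G y x z) (hG.bianchi hy u v w)
    simpa using this
  have A : ∀ u v w z, G y (coordCurvature G y v u w) z = - G y (coordCurvature G y u v w) z := by
    intro u v w z
    rw [coordCurvature_antisymm]; simp
  have S := hG.curvature_skew hy
  linarith [B a b c d, B b c d a, B c d a b, B d a b c, S a b c d, S b c a d, S c a b d,
    S b c d a, S c d b a, S d b c a, S c d a b, S d a c b, S a c d b, S d a b c, S a b d c,
    S b d a c, A a c b d, A b d c a, A c a d b, A a b c d, A b d a c, A c d a b, A a c d b,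
    A b d c a, A a d b c, A b c d a]

end IsLocalMetric

/-- The second fundamental form of `F` in coordinates. -/
def secondForm (G : E → E →L[ℝ] E →L[ℝ] ℝ) (G' : E' → E' →L[ℝ] E' →L[ℝ] ℝ) (F : E → E')
    (y u v : E) : E' :=
  fderiv ℝ (fun z => fderiv ℝ F z v) y u
    + christoffel G' (F y) (fderiv ℝ F y u) (fderiv ℝ F y v)
    - fderiv ℝ F y (christoffel G y u v)

/-- `F` is a smooth isometric map between two metric domains. -/
structure IsLocalIsometry (G : E → E →L[ℝ] E →L[ℝ] ℝ) (U : Set E)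
    (G' : E' → E' →L[ℝ] E' →L[ℝ] ℝ) (U' : Set E') (F : E → E') : Prop where
  source : IsLocalMetric G U
  target : IsLocalMetric G' U'
  mapsTo : Set.MapsTo F U U'
  contDiffOn : ContDiffOn ℝ ∞ F U
  isometry : ∀ y ∈ U, ∀ u v, G y u v = G' (F y) (fderiv ℝ F y u) (fderiv ℝ F y v)

/-- The Levi-Civita derivative in the target of the constant field `v` along `F`. -/
def ambientDeriv (G' : E' → E' →L[ℝ] E' →L[ℝ] ℝ) (F : E → E') (y u v : E) : E' :=
  fderiv ℝ (fderiv ℝ F) y u v + christoffelL G' (F y) (fderiv ℝ F y u) (fderiv ℝ F y v)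

/-! ### The Gauss equation for an isometric map of metric domains. -/

namespace IsLocalIsometry

variable {G : E → E →L[ℝ] E →L[ℝ] ℝ} {U : Set E} {G' : E' → E' →L[ℝ] E' →L[ℝ] ℝ} {U' : Set E'}
  {F : E → E'} [FiniteDimensional ℝ E] [FiniteDimensional ℝ E'] (h : IsLocalIsometry G U G' U' F)
include h

omit [FiniteDimensional ℝ E] [FiniteDimensional ℝ E'] in
lemma contDiffAt {y : E} (hy : y ∈ U) : ContDiffAt ℝ ∞ F y :=
  h.contDiffOn.contDiffAt (h.source.mem_nhds hy)

omit [FiniteDimensional ℝ E] [FiniteDimensional ℝ E'] in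
lemma differentiableAt {y : E} (hy : y ∈ U) : DifferentiableAt ℝ F y :=
  (h.contDiffAt hy).differentiableAt (by simp)

omit [FiniteDimensional ℝ E] [FiniteDimensional ℝ E'] in
lemma contDiffAt_fderiv {y : E} (hy : y ∈ U) : ContDiffAt ℝ ∞ (fderiv ℝ F) y :=
  (h.contDiffAt hy).fderiv_right (by simp)

omit [FiniteDimensional ℝ E] [FiniteDimensional ℝ E'] in
lemma differentiableAt_fderiv {y : E} (hy : y ∈ U) : DifferentiableAt ℝ (fderiv ℝ F) y :=
  (h.contDiffAt_fderiv hy).differentiableAt (by simp)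

omit [FiniteDimensional ℝ E] [FiniteDimensional ℝ E'] in
lemma differentiableAt_snd {y : E} (hy : y ∈ U) :
    DifferentiableAt ℝ (fderiv ℝ (fderiv ℝ F)) y :=
  ((h.contDiffAt_fderiv hy).fderiv_right (m := ∞) (by simp)).differentiableAt (by simp)

omit [FiniteDimensional ℝ E] [FiniteDimensional ℝ E'] in
lemma secondForm_eq {y : E} (hy : y ∈ U) (u v : E) :
    secondForm G G' F y u v = ambientDeriv G' F y u v - fderiv ℝ F y (christoffel G y u v) := by
  rw [secondForm, ambientDeriv, fderiv_apply_const (h.differentiableAt_fderiv hy),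
    christoffelL_apply]

omit [FiniteDimensional ℝ E] [FiniteDimensional ℝ E'] in
lemma secondForm_symm {y : E} (hy : y ∈ U) (u v : E) :
    secondForm G G' F y u v = secondForm G G' F y v u := by
  rw [h.secondForm_eq hy, h.secondForm_eq hy, ambientDeriv, ambientDeriv,
    snd_fderiv_symm (h.contDiffAt hy), christoffelL_apply, christoffelL_apply,
    h.source.christoffel_symm hy, h.target.christoffel_symm (h.mapsTo hy)]

/-- The tangential part of the ambient derivative is the intrinsic one. -/
lemma apply_ambientDeriv {y : E} (hy : y ∈ U) (u v w : E) :
    G' (F y) (ambientDeriv G' F y u v) (fderiv ℝ F y w) = G y (christoffel G y u v) w := by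
  -- The isometry relation is differentiated. In the Koszul combination, symmetry of D²F leaves only
  -- the term with D²F(u, v), which is the flat part of `ambientDeriv`.
  have hD : ∀ a b c, fderiv ℝ G y a b c =
      fderiv ℝ G' (F y) (fderiv ℝ F y a) (fderiv ℝ F y b) (fderiv ℝ F y c)
        + G' (F y) (fderiv ℝ (fderiv ℝ F) y a b) (fderiv ℝ F y c)
        + G' (F y) (fderiv ℝ F y b) (fderiv ℝ (fderiv ℝ F) y a c) := by
    intro a b c
    have hev : (fun z => G z b c) =ᶠ[nhds y]
        fun z => G' (F z) (fderiv ℝ F z b) (fderiv ℝ F z c) := by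
      filter_upwards [h.source.mem_nhds hy] with z hz using h.isometry z hz b c
    have hd : ∀ e, DifferentiableAt ℝ (fun z => fderiv ℝ F z e) y := fun e =>
      (h.differentiableAt_fderiv hy).clm_apply (differentiableAt_const e)
    rw [← fderiv_apply_const₂ (h.source.differentiableAt hy), hev.fderiv_eq,
      fderiv_metric_along (h.target.differentiableAt (h.mapsTo hy)) (h.differentiableAt hy)
        (hd b) (hd c), fderiv_apply_const (h.differentiableAt_fderiv hy),
      fderiv_apply_const (h.differentiableAt_fderiv hy)]
  have hs := snd_fderiv_symm (h.contDiffAt hy)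
  have hsym := h.target.symm (F y) (h.mapsTo hy)
  rw [ambientDeriv, map_add, add_apply, christoffelL_apply,
    h.target.apply_christoffel (h.mapsTo hy), h.source.apply_christoffel hy, hD, hD, hD,
    hs v u, hs w u, hs w v, hsym (fderiv ℝ F y v) (fderiv ℝ (fderiv ℝ F) y u w),
    hsym (fderiv ℝ F y u) (fderiv ℝ (fderiv ℝ F) y v w)]
  ring

/-- The second fundamental form is normal. -/
lemma apply_secondForm {y : E} (hy : y ∈ U) (u v w : E) :
    G' (F y) (secondForm G G' F y u v) (fderiv ℝ F y w) = 0 := by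
  rw [h.secondForm_eq hy, map_sub, sub_apply, h.apply_ambientDeriv hy, ← h.isometry y hy,
    sub_self]

/-- Pythagoras: the normal part `secondForm` and the tangential part are orthogonal, so the cross
terms drop. This product is the source of the quadratic terms of the Gauss equation. -/
lemma apply_ambientDeriv_ambientDeriv {y : E} (hy : y ∈ U) (u v w z : E) :
    G' (F y) (ambientDeriv G' F y u v) (ambientDeriv G' F y w z) =
      G y (christoffel G y u v) (christoffel G y w z)
        + G' (F y) (secondForm G G' F y u v) (secondForm G G' F y w z) := by
  have e : ∀ a b, ambientDeriv G' F y a b =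
      secondForm G G' F y a b + fderiv ℝ F y (christoffel G y a b) := by
    intro a b; rw [h.secondForm_eq hy]; abel
  rw [e, e]
  simp only [map_add, add_apply]
  rw [h.apply_secondForm hy, h.target.symm _ (h.mapsTo hy) (fderiv ℝ F y _),
    h.apply_secondForm hy, ← h.isometry y hy]
  ring

omit [FiniteDimensional ℝ E] in
lemma fderiv_ambientDeriv {y : E} (hy : y ∈ U) (v w : E) :
    DifferentiableAt ℝ (fun z => ambientDeriv G' F z v w) y ∧
    ∀ u, fderiv ℝ (fun z => ambientDeriv G' F z v w) y u =
      fderiv ℝ (fderiv ℝ (fderiv ℝ F)) y u v w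
        + fderiv ℝ (christoffelL G') (F y) (fderiv ℝ F y u) (fderiv ℝ F y v) (fderiv ℝ F y w)
        + christoffelL G' (F y) (fderiv ℝ (fderiv ℝ F) y u v) (fderiv ℝ F y w)
        + christoffelL G' (F y) (fderiv ℝ F y v) (fderiv ℝ (fderiv ℝ F) y u w) := by
  have hD := (h.differentiableAt_fderiv hy).hasFDerivAt
  have hv := hD.clm_apply (hasFDerivAt_const v y)
  have hw := hD.clm_apply (hasFDerivAt_const w y)
  have h2 := ((h.differentiableAt_snd hy).hasFDerivAt.clm_apply (hasFDerivAt_const v y)).clm_apply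
    (hasFDerivAt_const w y)
  have hΓ := ((((h.target.differentiableAt_christoffelL (h.mapsTo hy)).hasFDerivAt).comp y
    (h.differentiableAt hy).hasFDerivAt).clm_apply hv).clm_apply hw
  have H := h2.add hΓ
  refine ⟨H.differentiableAt, fun u => ?_⟩
  have e : fderiv ℝ (fun z => ambientDeriv G' F z v w) y = _ := H.fderiv
  rw [e]
  simp
  abel

omit [FiniteDimensional ℝ E] in
/-- The curvature of the pulled back connection is the pulled back curvature. -/
lemma ambientCurvature {y : E} (hy : y ∈ U) (u v w : E) :
    (fderiv ℝ (fun z => ambientDeriv G' F z v w) y u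
        + christoffel G' (F y) (fderiv ℝ F y u) (ambientDeriv G' F y v w))
      - (fderiv ℝ (fun z => ambientDeriv G' F z u w) y v
        + christoffel G' (F y) (fderiv ℝ F y v) (ambientDeriv G' F y u w)) =
      coordCurvature G' (F y) (fderiv ℝ F y u) (fderiv ℝ F y v) (fderiv ℝ F y w) := by
  -- D³F and D²F are symmetric in `u`, `v`, so they disappear on antisymmetrizing; what remains is
  -- the curvature of `G'`.
  rw [(h.fderiv_ambientDeriv hy v w).2, (h.fderiv_ambientDeriv hy u w).2,
    h.target.coordCurvature_eq (h.mapsTo hy), snd_fderiv_symm (h.contDiffAt hy) v u,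
    snd_fderiv_symm (h.contDiffAt_fderiv hy) v u, ← christoffelL_apply, ← christoffelL_apply]
  simp only [ambientDeriv, map_add]
  abel

/-- The Gauss equation. -/
theorem gauss {y : E} (hy : y ∈ U) (u v w z : E) :
    G y (coordCurvature G y u v w) z =
      G' (F y) (coordCurvature G' (F y) (fderiv ℝ F y u) (fderiv ℝ F y v) (fderiv ℝ F y w))
          (fderiv ℝ F y z)
        + G' (F y) (secondForm G G' F y v w) (secondForm G G' F y u z)
        - G' (F y) (secondForm G G' F y u w) (secondForm G G' F y v z) := by
  -- The relation G(Γ(b, w), z) = G'(∇̄_b w, DF z) is differentiated in direction `a`, using metric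
  -- compatibility on both sides. The leftover products differ by exactly ⟨h(b, w), h(a, z)⟩.
  have key : ∀ a b, G y (fderiv ℝ (fun x => christoffel G x b w) y a
        + christoffel G y a (christoffel G y b w)) z =
      G' (F y) (fderiv ℝ (fun x => ambientDeriv G' F x b w) y a
        + christoffel G' (F y) (fderiv ℝ F y a) (ambientDeriv G' F y b w)) (fderiv ℝ F y z)
        + G' (F y) (secondForm G G' F y b w) (secondForm G G' F y a z) := by
    intro a b
    have hev : (fun x => G x (christoffel G x b w) z) =ᶠ[nhds y]
        fun x => G' (F x) (ambientDeriv G' F x b w) (fderiv ℝ F x z) := by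
      filter_upwards [h.source.mem_nhds hy] with x hx using (h.apply_ambientDeriv hx b w z).symm
    have h1 := h.source.fderiv_apply_christoffel hy a b w z
    have h2 := h.target.fderiv_along (h.mapsTo hy) (h.differentiableAt hy)
      (h.fderiv_ambientDeriv hy b w).1
      ((h.differentiableAt_fderiv hy).clm_apply (differentiableAt_const z)) a
    rw [fderiv_apply_const (h.differentiableAt_fderiv hy), ← christoffelL_apply G' (F y) _
      (fderiv ℝ F y z)] at h2
    change _ = _ + G' (F y) (ambientDeriv G' F y b w) (ambientDeriv G' F y a z) at h2
    rw [h.apply_ambientDeriv_ambientDeriv hy] at h2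
    rw [hev.fderiv_eq, h2] at h1
    linarith
  rw [← h.ambientCurvature hy]
  have e : coordCurvature G y u v w =
      (fderiv ℝ (fun x => christoffel G x v w) y u + christoffel G y u (christoffel G y v w))
      - (fderiv ℝ (fun x => christoffel G x u w) y v
        + christoffel G y v (christoffel G y u w)) := by
    rw [coordCurvature]; abel
  rw [e, map_sub, sub_apply, key u v, key v u, map_sub, sub_apply]
  ring

end IsLocalIsometry

end CoordinateCalculus

/-! ### From charts to tangent spaces: the chart metric, Ricci and constant curvature. -/

section Charts

variable {m : ℕ} {M : Type*} [TopologicalSpace M] [ChartedSpace (EuclideanSpace ℝ (Fin m)) M]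

section Derivatives

variable [IsManifold (𝓡 m) ∞ M]

lemma mfderiv_symm_mfderiv_extChartAt {x y : M} (hy : y ∈ (extChartAt (𝓡 m) x).source)
    (u : TangentSpace (𝓡 m) y) :
    mfderiv 𝓘(ℝ, EuclideanSpace ℝ (Fin m)) (𝓡 m) (extChartAt (𝓡 m) x).symm (extChartAt (𝓡 m) x y)
      (mfderiv (𝓡 m) 𝓘(ℝ, EuclideanSpace ℝ (Fin m)) (extChartAt (𝓡 m) x) y u) = u := by
  have : IsManifold (𝓡 m) 1 M := IsManifold.of_le (n := ∞) (by simp)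
  have h := mfderivWithin_extChartAt_symm_comp_mfderiv_extChartAt' (I := 𝓡 m) hy
  rw [ModelWithCorners.range_eq_univ, mfderivWithin_univ] at h
  exact DFunLike.congr_fun h u

lemma mfderiv_mfderiv_symm_extChartAt {x : M} {y : EuclideanSpace ℝ (Fin m)}
    (hy : y ∈ (extChartAt (𝓡 m) x).target) (u : EuclideanSpace ℝ (Fin m)) :
    mfderiv (𝓡 m) 𝓘(ℝ, EuclideanSpace ℝ (Fin m)) (extChartAt (𝓡 m) x) ((extChartAt (𝓡 m) x).symm y)
      (mfderiv 𝓘(ℝ, EuclideanSpace ℝ (Fin m)) (𝓡 m) (extChartAt (𝓡 m) x).symm y u) = u := by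
  have : IsManifold (𝓡 m) 1 M := IsManifold.of_le (n := ∞) (by simp)
  have h := mfderiv_extChartAt_comp_mfderivWithin_extChartAt_symm (I := 𝓡 m) hy
  rw [ModelWithCorners.range_eq_univ, mfderivWithin_univ] at h
  exact DFunLike.congr_fun h u

lemma contMDiffOn_tangentMap_extChartAt_symm (x : M) (u : EuclideanSpace ℝ (Fin m)) :
    ContMDiffOn 𝓘(ℝ, EuclideanSpace ℝ (Fin m)) (𝓡 m).tangent ∞
      (fun y => (⟨(extChartAt (𝓡 m) x).symm y,
        mfderiv 𝓘(ℝ, EuclideanSpace ℝ (Fin m)) (𝓡 m) (extChartAt (𝓡 m) x).symm y u⟩ :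
          TangentBundle (𝓡 m) M)) (extChartAt (𝓡 m) x).target := by
  have hopen := isOpen_extChartAt_target (I := 𝓡 m) x
  have h1 := (contMDiffOn_extChartAt_symm (I := 𝓡 m) (n := ∞) x).contMDiffOn_tangentMapWithin
    (m := ∞) (by simp) hopen.uniqueMDiffOn
  have h2 : ContMDiffOn 𝓘(ℝ, EuclideanSpace ℝ (Fin m)) 𝓘(ℝ, EuclideanSpace ℝ (Fin m)).tangent ∞
      (fun y => (⟨y, u⟩ : TangentBundle 𝓘(ℝ, EuclideanSpace ℝ (Fin m))
        (EuclideanSpace ℝ (Fin m)))) (extChartAt (𝓡 m) x).target :=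
    contMDiffOn_vectorSpace_iff_contDiffOn.2 contDiffOn_const
  refine (h1.comp h2 fun y hy => hy).congr fun y hy => ?_
  simp only [Function.comp, tangentMapWithin, mfderivWithin_of_isOpen hopen hy]

end Derivatives

variable [Bundle.RiemannianBundle (fun x : M => TangentSpace (𝓡 m) x)]

lemma chartMetric_apply (x : M) (y u v : EuclideanSpace ℝ (Fin m)) :
    chartMetric m x y u v =
      inner ℝ (mfderiv 𝓘(ℝ, EuclideanSpace ℝ (Fin m)) (𝓡 m) (extChartAt (𝓡 m) x).symm y u)
        (mfderiv 𝓘(ℝ, EuclideanSpace ℝ (Fin m)) (𝓡 m) (extChartAt (𝓡 m) x).symm y v) :=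
  rfl

variable [IsManifold (𝓡 m) ∞ M]

lemma chartMetric_mfderiv_extChartAt {x y : M} (hy : y ∈ (extChartAt (𝓡 m) x).source)
    (u v : TangentSpace (𝓡 m) y) :
    chartMetric m x (extChartAt (𝓡 m) x y)
      (mfderiv (𝓡 m) 𝓘(ℝ, EuclideanSpace ℝ (Fin m)) (extChartAt (𝓡 m) x) y u)
      (mfderiv (𝓡 m) 𝓘(ℝ, EuclideanSpace ℝ (Fin m)) (extChartAt (𝓡 m) x) y v) = inner ℝ u v := by
  -- The images are named as vectors of the model space so that the base point obtained by a round
  -- trip through the chart can be replaced by `y`.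
  have key : ∀ a b : EuclideanSpace ℝ (Fin m),
      mfderiv (𝓡 m) 𝓘(ℝ, EuclideanSpace ℝ (Fin m)) (extChartAt (𝓡 m) x) y u = a →
      mfderiv (𝓡 m) 𝓘(ℝ, EuclideanSpace ℝ (Fin m)) (extChartAt (𝓡 m) x) y v = b →
      chartMetric m x (extChartAt (𝓡 m) x y) a b = inner ℝ u v := by
    intro a b ha hb
    have hu := mfderiv_symm_mfderiv_extChartAt hy u
    have hv := mfderiv_symm_mfderiv_extChartAt hy v
    rw [ha] at hu
    rw [hb] at hv
    rw [chartMetric_apply, hu, hv, (extChartAt (𝓡 m) x).left_inv hy]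
  exact key _ _ rfl rfl

lemma chartMetric_toCoord (x : M) (u v : TangentSpace (𝓡 m) x) :
    chartMetric m x (extChartAt (𝓡 m) x x) (toCoord m x u) (toCoord m x v) = inner ℝ u v :=
  chartMetric_mfderiv_extChartAt (mem_extChartAt_source x) u v

/-- `toCoord` as a linear equivalence. -/
def toCoordEquiv (x : M) : TangentSpace (𝓡 m) x ≃ₗ[ℝ] EuclideanSpace ℝ (Fin m) :=
  LinearEquiv.ofInjectiveOfFinrankEq
    (mfderiv (𝓡 m) 𝓘(ℝ, EuclideanSpace ℝ (Fin m)) (extChartAt (𝓡 m) x) x).toLinearMap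
    (by
      intro u v h
      have h' := congrArg (mfderiv 𝓘(ℝ, EuclideanSpace ℝ (Fin m)) (𝓡 m)
        (extChartAt (𝓡 m) x).symm (extChartAt (𝓡 m) x x)) h
      have hx := mem_extChartAt_source (I := 𝓡 m) x
      exact (mfderiv_symm_mfderiv_extChartAt hx u).symm.trans
        (h'.trans (mfderiv_symm_mfderiv_extChartAt hx v)))
    rfl

omit [Bundle.RiemannianBundle (fun x : M => TangentSpace (𝓡 m) x)] in
lemma toCoordEquiv_apply (x : M) (u : TangentSpace (𝓡 m) x) :
    toCoordEquiv x u = toCoord m x u := rfl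

lemma inner_toCoordEquiv_symm (x : M) (a b : EuclideanSpace ℝ (Fin m)) :
    inner ℝ ((toCoordEquiv x).symm a) ((toCoordEquiv x).symm b) =
      chartMetric m x (extChartAt (𝓡 m) x x) a b := by
  rw [← chartMetric_toCoord, ← toCoordEquiv_apply, ← toCoordEquiv_apply,
    LinearEquiv.apply_symm_apply, LinearEquiv.apply_symm_apply]

variable [IsContMDiffRiemannianBundle (𝓡 m) ∞ (EuclideanSpace ℝ (Fin m))
  (fun x : M => TangentSpace (𝓡 m) x)]

lemma isLocalMetric_chartMetric (x : M) :
    IsLocalMetric (chartMetric m x) (extChartAt (𝓡 m) x).target where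
  isOpen := isOpen_extChartAt_target x
  contDiffOn := by
    rw [contDiffOn_clm_apply]
    intro u
    rw [contDiffOn_clm_apply]
    intro v
    rw [← contMDiffOn_iff_contDiffOn]
    exact (contMDiffOn_tangentMap_extChartAt_symm x u).inner_bundle
      (contMDiffOn_tangentMap_extChartAt_symm x v)
  symm y _ u v := by
    rw [chartMetric_apply, chartMetric_apply, real_inner_comm]
  pos y hy v hv := by
    rw [chartMetric_apply]
    refine real_inner_self_pos.2 fun h => hv ?_
    have := mfderiv_mfderiv_symm_extChartAt hy v
    rw [h, map_zero] at this
    exact this.symm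

/-- Pair symmetry followed by antisymmetry in each pair. It makes `ricci` symmetric, so that
polarization applies. -/
lemma riemannTensor_symm (x : M) (e u v : TangentSpace (𝓡 m) x) :
    riemannTensor m x e u v e = riemannTensor m x e v u e := by
  have hG := isLocalMetric_chartMetric (m := m) x
  have hx := mem_extChartAt_target (I := 𝓡 m) x
  unfold riemannTensor
  rw [hG.curvature_pair_symm hx, coordCurvature_antisymm, map_neg, neg_apply,
    hG.curvature_skew hx, neg_neg]

lemma riemannTensor_add (x : M) (e u v w : TangentSpace (𝓡 m) x) :
    riemannTensor m x e u (v + w) e = riemannTensor m x e u v e + riemannTensor m x e u w e := by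
  have hG := isLocalMetric_chartMetric (m := m) x
  have hx := mem_extChartAt_target (I := 𝓡 m) x
  unfold riemannTensor
  rw [← add_apply, ← map_add]
  congr 2
  simp only [hG.coordCurvature_eq hx, ← toCoordEquiv_apply, map_add]
  abel

lemma ricci_symm (x : M) (u v : TangentSpace (𝓡 m) x) : ricci m x u v = ricci m x v u :=
  Finset.sum_congr rfl fun _ _ => riemannTensor_symm x _ u v

lemma ricci_add (x : M) (u v w : TangentSpace (𝓡 m) x) :
    ricci m x u (v + w) = ricci m x u v + ricci m x u w := by
  simp only [ricci, riemannTensor_add, Finset.sum_add_distrib]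

/-- The Ricci form is determined by its diagonal. -/
lemma isEinstein_of_ricci_self {μ : ℝ}
    (h : ∀ (x : M) (u : TangentSpace (𝓡 m) x), ricci m x u u = μ * ‖u‖ ^ 2) :
    IsEinstein m M := by
  refine ⟨μ, fun x u v => ?_⟩
  have h1 := h x (u + v)
  rw [ricci_add, ricci_symm x (u + v) u, ricci_symm x (u + v) v, ricci_add, ricci_add, h, h,
    ricci_symm x v u, norm_add_sq_real] at h1
  linarith

/-- In constant curvature, the biquadratic form of the curvature tensor. -/
lemma HasConstantCurvature.riemannTensor_eq {c : ℝ} (h : HasConstantCurvature m M c) (x : M)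
    (u v : TangentSpace (𝓡 m) x) :
    riemannTensor m x u v v u = c * (‖u‖ ^ 2 * ‖v‖ ^ 2 - inner ℝ u v ^ 2) := by
  have hG := isLocalMetric_chartMetric (m := m) x
  have hx := mem_extChartAt_target (I := 𝓡 m) x
  by_cases hli : LinearIndependent ℝ ![u, v]
  · have h1 := h x u v hli
    -- The Gram determinant of an independent pair is positive, by the equality case of
    -- Cauchy-Schwarz.
    have hpos : 0 < inner ℝ u u * inner ℝ v v - inner ℝ u v ^ 2 := by
      have hle := real_inner_mul_inner_self_le u v
      refine lt_of_le_of_ne (by linarith [sq (inner ℝ u v)]) fun h0 => ?_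
      have hu : u ≠ 0 := hli.ne_zero 0
      have heq : |inner ℝ u v| = ‖u‖ * ‖v‖ := by
        rw [real_inner_self_eq_norm_sq, real_inner_self_eq_norm_sq] at h0
        rw [← Real.sqrt_sq_eq_abs, show inner ℝ u v ^ 2 = (‖u‖ * ‖v‖) ^ 2 by linarith [h0],
          Real.sqrt_sq (by positivity)]
      have hv : v ≠ 0 := hli.ne_zero 1
      obtain ⟨r, hr⟩ := ((abs_real_inner_div_norm_mul_norm_eq_one_iff u v).1 (by
        rw [abs_div, heq, abs_of_nonneg (by positivity : 0 ≤ ‖u‖ * ‖v‖)]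
        exact div_self (by positivity))).2
      have := LinearIndependent.pair_iff.1 hli r (-1) (by rw [hr.2]; simp)
      simp at this
    rw [sectionalCurvature, div_eq_iff hpos.ne'] at h1
    rw [h1, real_inner_self_eq_norm_sq, real_inner_self_eq_norm_sq]
  -- A dependent pair spans no plane, so the curvature hypothesis is silent; here both sides vanish,
  -- the left one by antisymmetry after extracting the scalar.
  · have key : (∃ t : ℝ, u = t • v) ∨ ∃ t : ℝ, v = t • u := by
      rw [LinearIndependent.pair_iff] at hli
      push Not at hli
      obtain ⟨s, t, hst, hne⟩ := hli
      by_cases hs : s = 0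
      · right
        refine ⟨0, ?_⟩
        have ht := hne hs
        subst hs
        simpa [ht] using hst
      · left
        refine ⟨-(s⁻¹ * t), ?_⟩
        have : s • u = -(t • v) := eq_neg_of_add_eq_zero_left hst
        rw [neg_smul, mul_smul, ← smul_neg, ← this, smul_smul, inv_mul_cancel₀ hs, one_smul]
    have hz : ∀ a w, coordCurvature (chartMetric m x) (extChartAt (𝓡 m) x x) a a w = 0 := by
      intro a w
      simp [coordCurvature]
    rcases key with ⟨t, rfl⟩ | ⟨t, rfl⟩
    · have e : riemannTensor m x (t • v) v v (t • v) = 0 := by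
        have e1 : coordCurvature (chartMetric m x) (extChartAt (𝓡 m) x x) (toCoord m x (t • v))
            (toCoord m x v) (toCoord m x v) = t • coordCurvature (chartMetric m x)
              (extChartAt (𝓡 m) x x) (toCoord m x v) (toCoord m x v) (toCoord m x v) := by
          simp only [hG.coordCurvature_eq hx, ← toCoordEquiv_apply, map_smul, smul_apply]
          module
        rw [riemannTensor, e1, hz]
        simp
      rw [e, norm_smul, inner_smul_left, real_inner_self_eq_norm_sq, mul_pow, Real.norm_eq_abs,
        sq_abs]
      simp; ring_nf; simp
    · have e : riemannTensor m x u (t • u) (t • u) u = 0 := by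
        have e1 : coordCurvature (chartMetric m x) (extChartAt (𝓡 m) x x) (toCoord m x u)
            (toCoord m x (t • u)) (toCoord m x (t • u)) = t • coordCurvature (chartMetric m x)
              (extChartAt (𝓡 m) x x) (toCoord m x u) (toCoord m x u) (toCoord m x (t • u)) := by
          simp only [hG.coordCurvature_eq hx, ← toCoordEquiv_apply, map_smul, smul_apply]
          module
        rw [riemannTensor, e1, hz]
        simp
      rw [e, norm_smul, inner_smul_right, real_inner_self_eq_norm_sq, mul_pow, Real.norm_eq_abs,
        sq_abs]
      ring

end Charts

/-! ### Isometric immersions read in charts. -/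

section Immersions

variable {n k : ℕ}
  {M : Type*} [TopologicalSpace M] [ChartedSpace (EuclideanSpace ℝ (Fin n)) M]
  [IsManifold (𝓡 n) ∞ M]
  [Bundle.RiemannianBundle (fun x : M => TangentSpace (𝓡 n) x)]
  {N : Type*} [TopologicalSpace N] [ChartedSpace (EuclideanSpace ℝ (Fin k)) N]
  [IsManifold (𝓡 k) ∞ N]
  [Bundle.RiemannianBundle (fun x : N => TangentSpace (𝓡 k) x)]
  {f : M → N}

/-- The part of the chart at `x` which `f` maps to the chart at `f x`. -/
def coordDomain (n k : ℕ) {M : Type*} [TopologicalSpace M]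
    [ChartedSpace (EuclideanSpace ℝ (Fin n)) M]
    {N : Type*} [TopologicalSpace N] [ChartedSpace (EuclideanSpace ℝ (Fin k)) N]
    (f : M → N) (x : M) : Set (EuclideanSpace ℝ (Fin n)) :=
  (extChartAt (𝓡 n) x).target ∩
    (extChartAt (𝓡 n) x).symm ⁻¹' (f ⁻¹' (extChartAt (𝓡 k) (f x)).source)

omit [IsManifold (𝓡 n) ∞ M] [Bundle.RiemannianBundle (fun x : M => TangentSpace (𝓡 n) x)]
  [IsManifold (𝓡 k) ∞ N] [Bundle.RiemannianBundle (fun x : N => TangentSpace (𝓡 k) x)] in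
lemma mem_coordDomain (x : M) : extChartAt (𝓡 n) x x ∈ coordDomain n k f x :=
  ⟨mem_extChartAt_target x, by simp⟩

namespace IsIsometricImmersion

variable (hf : IsIsometricImmersion n k f)
include hf

omit [IsManifold (𝓡 n) ∞ M] [IsManifold (𝓡 k) ∞ N] in
lemma isOpen_coordDomain (x : M) : IsOpen (coordDomain n k f x) :=
  (continuousOn_extChartAt_symm x).isOpen_inter_preimage (isOpen_extChartAt_target x)
    ((isOpen_extChartAt_source (f x)).preimage hf.contMDiff.continuous)

lemma contDiffOn_coordMap (x : M) : ContDiffOn ℝ ∞ (coordMap n k f x) (coordDomain n k f x) := by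
  rw [← contMDiffOn_iff_contDiffOn]
  exact (contMDiffOn_extChartAt (I := 𝓡 k) (x := f x)).comp
    ((hf.contMDiff.comp_contMDiffOn (contMDiffOn_extChartAt_symm (I := 𝓡 n) x)).mono
      Set.inter_subset_left) fun y hy => by simpa using hy.2

lemma fderiv_coordMap (x : M) {y : EuclideanSpace ℝ (Fin n)} (hy : y ∈ coordDomain n k f x)
    (u : EuclideanSpace ℝ (Fin n)) :
    fderiv ℝ (coordMap n k f x) y u =
      mfderiv (𝓡 k) 𝓘(ℝ, EuclideanSpace ℝ (Fin k)) (extChartAt (𝓡 k) (f x))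
        (f ((extChartAt (𝓡 n) x).symm y))
        (mfderiv (𝓡 n) (𝓡 k) f ((extChartAt (𝓡 n) x).symm y)
          (mfderiv 𝓘(ℝ, EuclideanSpace ℝ (Fin n)) (𝓡 n) (extChartAt (𝓡 n) x).symm y u)) := by
  have h1 : MDifferentiableAt 𝓘(ℝ, EuclideanSpace ℝ (Fin n)) (𝓡 n) (extChartAt (𝓡 n) x).symm y :=
    ((contMDiffOn_extChartAt_symm (I := 𝓡 n) (n := ∞) x).contMDiffAt
      ((isOpen_extChartAt_target x).mem_nhds hy.1)).mdifferentiableAt (by simp)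
  have h2 : MDifferentiableAt (𝓡 n) (𝓡 k) f ((extChartAt (𝓡 n) x).symm y) :=
    hf.contMDiff.mdifferentiableAt (by simp)
  have h3 : MDifferentiableAt (𝓡 k) 𝓘(ℝ, EuclideanSpace ℝ (Fin k)) (extChartAt (𝓡 k) (f x))
      (f ((extChartAt (𝓡 n) x).symm y)) :=
    (contMDiffAt_extChartAt' (I := 𝓡 k) (n := ∞) (by simpa using hy.2)).mdifferentiableAt (by simp)
  have h := (h3.hasMFDerivAt.comp y (h2.hasMFDerivAt.comp y h1.hasMFDerivAt))
  let D : EuclideanSpace ℝ (Fin n) →L[ℝ] EuclideanSpace ℝ (Fin k) :=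
    (mfderiv (𝓡 k) 𝓘(ℝ, EuclideanSpace ℝ (Fin k)) (extChartAt (𝓡 k) (f x))
      (f ((extChartAt (𝓡 n) x).symm y))).comp
      ((mfderiv (𝓡 n) (𝓡 k) f ((extChartAt (𝓡 n) x).symm y)).comp
        (mfderiv 𝓘(ℝ, EuclideanSpace ℝ (Fin n)) (𝓡 n) (extChartAt (𝓡 n) x).symm y))
  have h' : HasFDerivAt (coordMap n k f x) D y := hasMFDerivAt_iff_hasFDerivAt.1 h
  rw [h'.fderiv]
  rfl

/-- The differential in coordinates. -/
lemma fderiv_coordMap_toCoord (x : M) (u : TangentSpace (𝓡 n) x) :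
    fderiv ℝ (coordMap n k f x) (extChartAt (𝓡 n) x x) (toCoord n x u) =
      toCoord k (f x) (mfderiv (𝓡 n) (𝓡 k) f x u) := by
  rw [hf.fderiv_coordMap x (mem_coordDomain x), toCoord,
    mfderiv_symm_mfderiv_extChartAt (mem_extChartAt_source x), toCoord, extChartAt_to_inv]

variable [IsContMDiffRiemannianBundle (𝓡 n) ∞ (EuclideanSpace ℝ (Fin n))
    (fun x : M => TangentSpace (𝓡 n) x)]
  [IsContMDiffRiemannianBundle (𝓡 k) ∞ (EuclideanSpace ℝ (Fin k))
    (fun x : N => TangentSpace (𝓡 k) x)]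

lemma isLocalIsometry (x : M) :
    IsLocalIsometry (chartMetric n x) (coordDomain n k f x) (chartMetric k (f x))
      (extChartAt (𝓡 k) (f x)).target (coordMap n k f x) where
  source := (isLocalMetric_chartMetric x).mono (hf.isOpen_coordDomain x) Set.inter_subset_left
  target := isLocalMetric_chartMetric (f x)
  mapsTo y hy := (extChartAt (𝓡 k) (f x)).map_source hy.2
  contDiffOn := hf.contDiffOn_coordMap x
  isometry y hy u v := by
    rw [hf.fderiv_coordMap x hy, hf.fderiv_coordMap x hy, coordMap,
      chartMetric_mfderiv_extChartAt hy.2, hf.inner_mfderiv, chartMetric_apply]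

end IsIsometricImmersion

end Immersions

/-! ### The Gauss equation for submanifolds and the Casorati-ideal case. -/

section Submanifolds

variable {n k : ℕ}
  {M : Type*} [TopologicalSpace M] [ChartedSpace (EuclideanSpace ℝ (Fin n)) M]
  [IsManifold (𝓡 n) ∞ M]
  [Bundle.RiemannianBundle (fun x : M => TangentSpace (𝓡 n) x)]
  [IsContMDiffRiemannianBundle (𝓡 n) ∞ (EuclideanSpace ℝ (Fin n))
    (fun x : M => TangentSpace (𝓡 n) x)]
  {N : Type*} [TopologicalSpace N] [ChartedSpace (EuclideanSpace ℝ (Fin k)) N]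
  [IsManifold (𝓡 k) ∞ N]
  [Bundle.RiemannianBundle (fun x : N => TangentSpace (𝓡 k) x)]
  [IsContMDiffRiemannianBundle (𝓡 k) ∞ (EuclideanSpace ℝ (Fin k))
    (fun x : N => TangentSpace (𝓡 k) x)]
  {f : M → N}

namespace IsIsometricImmersion

variable (hf : IsIsometricImmersion n k f)

omit [IsManifold (𝓡 n) ∞ M] [IsManifold (𝓡 k) ∞ N]
  [Bundle.RiemannianBundle (fun x : M => TangentSpace (𝓡 n) x)]
  [IsContMDiffRiemannianBundle (𝓡 n) ∞ (EuclideanSpace ℝ (Fin n))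
    (fun x : M => TangentSpace (𝓡 n) x)]
  [Bundle.RiemannianBundle (fun x : N => TangentSpace (𝓡 k) x)]
  [IsContMDiffRiemannianBundle (𝓡 k) ∞ (EuclideanSpace ℝ (Fin k))
    (fun x : N => TangentSpace (𝓡 k) x)] in
lemma coordMap_extChartAt (f : M → N) (x : M) :
    coordMap n k f x (extChartAt (𝓡 n) x x) = extChartAt (𝓡 k) (f x) (f x) := by
  rw [coordMap, extChartAt_to_inv]

omit [IsManifold (𝓡 n) ∞ M] [IsManifold (𝓡 k) ∞ N]
  [IsContMDiffRiemannianBundle (𝓡 n) ∞ (EuclideanSpace ℝ (Fin n))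
    (fun x : M => TangentSpace (𝓡 n) x)]
  [IsContMDiffRiemannianBundle (𝓡 k) ∞ (EuclideanSpace ℝ (Fin k))
    (fun x : N => TangentSpace (𝓡 k) x)] in
lemma coordSecondForm_eq (f : M → N) (x : M) (u v : EuclideanSpace ℝ (Fin n)) :
    coordSecondForm n k f x u v = secondForm (chartMetric n x) (chartMetric k (f x))
      (coordMap n k f x) (extChartAt (𝓡 n) x x) u v := by
  rw [coordSecondForm, secondForm, coordMap_extChartAt]

include hf in
lemma coordSecondForm_bilin (x : M) : ∃ B : EuclideanSpace ℝ (Fin n) →ₗ[ℝ]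
    EuclideanSpace ℝ (Fin n) →ₗ[ℝ] EuclideanSpace ℝ (Fin k),
    ∀ u v, B u v = coordSecondForm n k f x u v := by
  have e : ∀ u v, coordSecondForm n k f x u v = _ := fun u v =>
    (coordSecondForm_eq f x u v).trans
      ((hf.isLocalIsometry x).secondForm_eq (mem_coordDomain x) u v)
  refine ⟨LinearMap.mk₂ ℝ (coordSecondForm n k f x) ?_ ?_ ?_ ?_, fun _ _ => rfl⟩
  all_goals
    intros
    simp only [e, ambientDeriv, ← christoffelL_apply, map_add, map_smul, add_apply, smul_apply]
    module

/-- The second fundamental form, as a bilinear map into the tangent space of the ambient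
manifold. -/
def shape (x : M) : TangentSpace (𝓡 n) x →ₗ[ℝ] TangentSpace (𝓡 n) x →ₗ[ℝ]
    TangentSpace (𝓡 k) (f x) :=
  ((hf.coordSecondForm_bilin x).choose.compl₁₂ (toCoordEquiv x).toLinearMap
    (toCoordEquiv x).toLinearMap).compr₂ (toCoordEquiv (f x)).symm.toLinearMap

lemma shape_apply (x : M) (u v : TangentSpace (𝓡 n) x) :
    hf.shape x u v = (toCoordEquiv (f x)).symm
      (coordSecondForm n k f x (toCoord n x u) (toCoord n x v)) := by
  rw [← (hf.coordSecondForm_bilin x).choose_spec]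
  rfl

lemma shape_symm (x : M) (u v : TangentSpace (𝓡 n) x) : hf.shape x u v = hf.shape x v u := by
  rw [shape_apply, shape_apply, coordSecondForm_eq, coordSecondForm_eq,
    (hf.isLocalIsometry x).secondForm_symm (mem_coordDomain x)]

lemma normSqSecondForm_eq (x : M) (u v : TangentSpace (𝓡 n) x) :
    normSqSecondForm n k f x u v = ‖hf.shape x u v‖ ^ 2 := by
  rw [← real_inner_self_eq_norm_sq, shape_apply, inner_toCoordEquiv_symm, normSqSecondForm]

lemma isTotallyGeodesic_iff : IsTotallyGeodesic n k f ↔ ∀ x, hf.shape x = 0 := by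
  refine forall_congr' fun x => ⟨fun h => ?_, fun h u v => ?_⟩
  · ext u v
    rw [shape_apply, h]
    simp
  · have := hf.shape_apply x u v
    rw [h] at this
    simpa using this.symm

/-- The Gauss equation for a submanifold. -/
theorem gauss_equation (x : M) (u v w z : TangentSpace (𝓡 n) x) :
    riemannTensor n x u v w z =
      riemannTensor k (f x) (mfderiv (𝓡 n) (𝓡 k) f x u) (mfderiv (𝓡 n) (𝓡 k) f x v)
          (mfderiv (𝓡 n) (𝓡 k) f x w) (mfderiv (𝓡 n) (𝓡 k) f x z)
        + inner ℝ (hf.shape x v w) (hf.shape x u z)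
        - inner ℝ (hf.shape x u w) (hf.shape x v z) := by
  simp only [shape_apply, inner_toCoordEquiv_symm]
  simp only [riemannTensor, ← hf.fderiv_coordMap_toCoord]
  rw [(hf.isLocalIsometry x).gauss (mem_coordDomain x)]
  simp only [coordSecondForm_eq, coordMap_extChartAt]

lemma riemannTensor_self {c : ℝ} (hN : HasConstantCurvature k N c) (x : M)
    (u v : TangentSpace (𝓡 n) x) :
    riemannTensor n x u v v u = c * (‖u‖ ^ 2 * ‖v‖ ^ 2 - inner ℝ u v ^ 2)
      + inner ℝ (hf.shape x v v) (hf.shape x u u) - ‖hf.shape x u v‖ ^ 2 := by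
  rw [hf.gauss_equation, hN.riemannTensor_eq, ← real_inner_self_eq_norm_sq,
    ← real_inner_self_eq_norm_sq, hf.inner_mfderiv, hf.inner_mfderiv, hf.inner_mfderiv,
    hf.shape_symm x v u]
  simp only [real_inner_self_eq_norm_sq]

/-- The Gauss equation is summed over the frame; Parseval turns n‖u‖² - ∑⟨e_i, u⟩² into (n-1)‖u‖².
-/
lemma ricci_self {c : ℝ} (hN : HasConstantCurvature k N c) (x : M) (u : TangentSpace (𝓡 n) x) :
    ricci n x u u = ((n : ℝ) - 1) * c * ‖u‖ ^ 2
      + (inner ℝ (hf.shape x u u) (∑ i, hf.shape x (tangentFrame n x i) (tangentFrame n x i))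
      - ∑ i, ‖hf.shape x (tangentFrame n x i) u‖ ^ 2) := by
  simp only [ricci, hf.riemannTensor_self hN, Finset.sum_add_distrib, Finset.sum_sub_distrib,
    ← Finset.mul_sum, ← inner_sum, OrthonormalBasis.norm_eq_one, one_pow, one_mul,
    OrthonormalBasis.sum_sq_inner_right, Finset.sum_const, Finset.card_univ, Fintype.card_fin,
    nsmul_eq_mul]
  ring

/-- Diagonal curvature terms vanish, so twice the sum over i < j is the full double sum, to which
the Gauss equation applies termwise. -/
lemma two_mul_scalarCurvature {c : ℝ} (hN : HasConstantCurvature k N c) (x : M) :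
    2 * scalarCurvature n x = (n : ℝ) * ((n : ℝ) - 1) * c
      + ‖∑ i, hf.shape x (tangentFrame n x i) (tangentFrame n x i)‖ ^ 2
      - frameNormSq (hf.shape x) (tangentFrame n x) := by
  set b := tangentFrame n x with hb
  have hon := orthonormal_iff_ite.1 b.orthonormal
  have e : scalarCurvature n x = ∑ i, ∑ j ∈ Finset.univ.filter (fun j => i < j),
      riemannTensor n x (b i) (b j) (b j) (b i) := by
    refine Finset.sum_congr rfl fun i _ => Finset.sum_congr rfl fun j hj => ?_
    have hij : i ≠ j := (Finset.mem_filter.1 hj).2.ne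
    rw [sectionalCurvature, ← hb, hon, hon, hon]
    simp [hij]
  rw [e, two_mul_sum_lt]
  · simp only [hf.riemannTensor_self hN, Finset.sum_add_distrib, Finset.sum_sub_distrib,
      ← Finset.mul_sum, OrthonormalBasis.norm_eq_one, one_pow, one_mul, frameNormSq, hon]
    rw [← real_inner_self_eq_norm_sq, sum_inner]
    simp only [inner_sum]
    simp only [Finset.sum_const, Finset.card_univ, Fintype.card_fin, nsmul_eq_mul, mul_one,
      ite_pow, one_pow, ne_eq, OfNat.ofNat_ne_zero, not_false_eq_true, zero_pow,
      Finset.sum_ite_eq, Finset.mem_univ, if_true]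
    rw [Finset.sum_comm (f := fun i j => inner ℝ ((hf.shape x (b j)) (b j))
      ((hf.shape x (b i)) (b i)))]
    ring
  · intro i j
    rw [hf.riemannTensor_self hN, hf.riemannTensor_self hN, real_inner_comm (b i),
      real_inner_comm (hf.shape x (b i) (b i)), hf.shape_symm x (b i) (b j)]
    ring
  · intro i
    rw [hf.riemannTensor_self hN, real_inner_self_eq_norm_sq, real_inner_self_eq_norm_sq]
    ring

lemma casorati_eq (x : M) :
    casorati n k f x = 1 / (n : ℝ) * frameNormSq (hf.shape x) (tangentFrame n x) := by
  simp only [casorati, frameNormSq, hf.normSqSecondForm_eq]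

omit [ChartedSpace (EuclideanSpace ℝ (Fin n)) M] [IsManifold (𝓡 n) ∞ M]
  [Bundle.RiemannianBundle (fun x : M => TangentSpace (𝓡 n) x)]
  [IsContMDiffRiemannianBundle (𝓡 n) ∞ (EuclideanSpace ℝ (Fin n))
    (fun x : M => TangentSpace (𝓡 n) x)] in
lemma finrank_tangentSpace [ChartedSpace (EuclideanSpace ℝ (Fin n)) M] (x : M) :
    Module.finrank ℝ (TangentSpace (𝓡 n) x) = n :=
  (LinearEquiv.refl ℝ (EuclideanSpace ℝ (Fin n))).finrank_eq.trans finrank_euclideanSpace_fin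

lemma hyperplaneCasorati_eq (x : M) :
    hyperplaneCasorati n k f x = hyperplaneValues (hf.shape x) := by
  simp only [hyperplaneCasorati, hyperplaneValues, casoratiSubspace, frameNormSq,
    hf.normSqSecondForm_eq, finrank_tangentSpace]

/-- If the Casorati inequality with weights `α`, `β` is an equality for some hyperplane and `M` is
Einstein, then the second fundamental form vanishes. -/
lemma shape_eq_zero {c : ℝ} (hn : 3 ≤ n) (hN : HasConstantCurvature k N c)
    (hE : IsEinstein n M) (x : M) {α β : ℝ} (hα : 0 < α) (hβ : 0 < β)
    (hαβ : ((n : ℝ) - 1) / α + 1 / β = 1) (hne : 1 / α - (1 / α) ^ 2 ≠ 1 / β - (1 / β) ^ 2)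
    {a : ℝ} (ha : a ∈ hyperplaneCasorati n k f x)
    (hideal : (n : ℝ) * ((n : ℝ) - 1) * (normalizedScalarCurvature n x - c)
        + frameNormSq (hf.shape x) (tangentFrame n x) =
      α * (((n : ℝ) - 1) * a)
        + β * (frameNormSq (hf.shape x) (tangentFrame n x) - ((n : ℝ) - 1) * a)) :
    hf.shape x = 0 := by
  obtain ⟨μ, hμ⟩ := hE
  rw [hf.hyperplaneCasorati_eq] at ha
  obtain ⟨L, hL, rfl⟩ := ha
  obtain ⟨ξ, hξ, hξ1⟩ := exists_unit_normal L hL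
  obtain ⟨b, -, hb⟩ := exists_basis_extending_hyperplane L hL hξ hξ1
  have hLn : Module.finrank ℝ L + 1 = n := hL.trans (finrank_tangentSpace x)
  have hL1 : (Module.finrank ℝ L : ℝ) = (n : ℝ) - 1 := by
    have : ((Module.finrank ℝ L + 1 : ℕ) : ℝ) = n := congrArg _ hLn
    push_cast at this
    linarith
  have hn0 : (3 : ℝ) ≤ n := by exact_mod_cast hn
  have : Nonempty (Fin (Module.finrank ℝ L)) := ⟨⟨0, by omega⟩⟩
  have hT : ∑ i, hf.shape x (tangentFrame n x i) (tangentFrame n x i) =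
      ∑ i, hf.shape x (b i) (b i) := trace_bilin_eq _ _ _
  -- The Einstein constant is reduced by (n-1)c, the ambient contribution to the Ricci form in
  -- `ricci_self`.
  refine eq_zero_of_ideal_of_einstein (hf.shape x) (hf.shape_symm x) b hα hβ
    (by rw [Fintype.card_fin, hL1]; exact hαβ) hne ?_ (μ := μ - ((n : ℝ) - 1) * c) fun u => ?_
  · have hS := frameNormSq_eq (hf.shape x) (tangentFrame n x) b
    have hS' := frameNormSq_option (hf.shape x) (hf.shape_symm x) b
    have h2 := hf.two_mul_scalarCurvature hN x
    rw [normalizedScalarCurvature, hL1] at hideal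
    simp only [← hb] at hideal
    have e1 : (n : ℝ) * ((n : ℝ) - 1) * (2 * scalarCurvature n x / ((n : ℝ) * ((n : ℝ) - 1)) - c) =
        2 * scalarCurvature n x - (n : ℝ) * ((n : ℝ) - 1) * c := by
      have : (n : ℝ) - 1 ≠ 0 := by linarith
      field_simp
    have e2 : ((n : ℝ) - 1) * (1 / ((n : ℝ) - 1) *
        frameNormSq (hf.shape x) (fun i => b (some i))) =
        frameNormSq (hf.shape x) (fun i => b (some i)) := by
      have : (n : ℝ) - 1 ≠ 0 := by linarith
      field_simp
    rw [e1, h2, e2, hS, hT] at hideal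
    have e3 : 2 * ∑ i, ‖hf.shape x (b (some i)) (b none)‖ ^ 2
        + ‖hf.shape x (b none) (b none)‖ ^ 2 =
        frameNormSq (hf.shape x) b - frameNormSq (hf.shape x) (fun i => b (some i)) := by
      linarith
    rw [e3]
    linarith
  · have h1 := hf.ricci_self hN x u
    rw [hμ, real_inner_self_eq_norm_sq, hT,
      sum_norm_sq_left_eq (hf.shape x) (tangentFrame n x) b] at h1
    linarith

include hf in
lemma isEinstein_of_isTotallyGeodesic {c : ℝ} (hN : HasConstantCurvature k N c)
    (h : IsTotallyGeodesic n k f) : IsEinstein n M := by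
  rw [hf.isTotallyGeodesic_iff] at h
  refine isEinstein_of_ricci_self (μ := ((n : ℝ) - 1) * c) fun x u => ?_
  rw [hf.ricci_self hN, h x]
  simp

include hf in
lemma hyperplaneCasorati_isCompact_nonempty (hn : 3 ≤ n) (x : M) :
    IsCompact (hyperplaneCasorati n k f x) ∧ (hyperplaneCasorati n k f x).Nonempty := by
  rw [hf.hyperplaneCasorati_eq]
  have : Nontrivial (TangentSpace (𝓡 n) x) :=
    Module.nontrivial_of_finrank_pos (R := ℝ) (by rw [finrank_tangentSpace]; omega)
  exact ⟨isCompact_hyperplaneValues _ (hf.shape_symm x), hyperplaneValues_nonempty _⟩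

include hf in
theorem isTotallyGeodesic_of_idealHat {c : ℝ} (hn : 3 ≤ n) (hN : HasConstantCurvature k N c)
    (hE : IsEinstein n M) (hI : IsCasoratiIdealHat n k c f) : IsTotallyGeodesic n k f := by
  rw [hf.isTotallyGeodesic_iff]
  intro x
  have hn0 : (3 : ℝ) ≤ n := by exact_mod_cast hn
  obtain ⟨hc, h0⟩ := hf.hyperplaneCasorati_isCompact_nonempty hn x
  have h2n : (0 : ℝ) < 2 * n - 1 := by linarith
  -- With P = (n-1) sup 𝒞(L), the ideal condition reads ‖T‖² = (2n-1)S - (2n-1)P/2, so S - P has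
  -- weight 2n-1 and P half of it.
  refine hf.shape_eq_zero hn hN hE x (α := (2 * n - 1) / 2) (β := 2 * n - 1) (by linarith) h2n
    ?_ ?_ (hc.sSup_mem h0) ?_
  · rw [div_div_eq_mul_div, ← add_div, div_eq_one_iff_eq h2n.ne']
    ring
  -- Equality of the two Ricci coefficients would give 2n - 1 = 3, contrary to n ≥ 3.
  · intro h
    field_simp at h
    nlinarith
  · have hn1 : (n : ℝ) ≠ 0 := by linarith
    rw [hI x, deltaHatCasorati, hf.casorati_eq]
    field_simp
    ring

include hf in
theorem isTotallyGeodesic_of_ideal {c : ℝ} (hn : 3 ≤ n) (hN : HasConstantCurvature k N c)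
    (hE : IsEinstein n M) (hI : IsCasoratiIdeal n k c f) : IsTotallyGeodesic n k f := by
  rw [hf.isTotallyGeodesic_iff]
  intro x
  have hn0 : (3 : ℝ) ≤ n := by exact_mod_cast hn
  obtain ⟨hc, h0⟩ := hf.hyperplaneCasorati_isCompact_nonempty hn x
  have h2n : (0 : ℝ) < n + 1 := by linarith
  -- With P = (n-1) inf 𝒞(L), the ideal condition reads ‖T‖² = (n+1)(S + P)/2, so S - P has weight
  -- (n+1)/2 and P twice that.
  refine hf.shape_eq_zero hn hN hE x (α := n + 1) (β := (n + 1) / 2) h2n (by linarith)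
    ?_ ?_ (hc.sInf_mem h0) ?_
  · field_simp; ring
  -- Here equality of the coefficients would give n + 1 = 3.
  · intro h
    field_simp at h
    nlinarith
  · have hn1 : (n : ℝ) ≠ 0 := by linarith
    rw [hI x, deltaCasorati, hf.casorati_eq]
    field_simp
    ring

end IsIsometricImmersion

end Submanifolds

end Casorati

end

end

theorem theorem5p3 (n p : ℕ) (hn : 3 ≤ n) (c : ℝ)
    (M : Type*) [TopologicalSpace M] [ChartedSpace (EuclideanSpace ℝ (Fin n)) M]
    [IsManifold (𝓡 n) ∞ M]
    [Bundle.RiemannianBundle (fun x : M => TangentSpace (𝓡 n) x)]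
    [IsContMDiffRiemannianBundle (𝓡 n) ∞ (EuclideanSpace ℝ (Fin n))
      (fun x : M => TangentSpace (𝓡 n) x)]
    (N : Type*) [TopologicalSpace N] [ChartedSpace (EuclideanSpace ℝ (Fin (n + p))) N]
    [IsManifold (𝓡 (n + p)) ∞ N]
    [Bundle.RiemannianBundle (fun x : N => TangentSpace (𝓡 (n + p)) x)]
    [IsContMDiffRiemannianBundle (𝓡 (n + p)) ∞ (EuclideanSpace ℝ (Fin (n + p)))
      (fun x : N => TangentSpace (𝓡 (n + p)) x)]
    (hN : Casorati.HasConstantCurvature (n + p) N c)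
    (f : M → N) (hf : Casorati.IsIsometricImmersion n (n + p) f) :
    (Casorati.IsCasoratiIdealHat n (n + p) c f →
      (Casorati.IsEinstein n M ↔ Casorati.IsTotallyGeodesic n (n + p) f)) ∧
    (Casorati.IsCasoratiIdeal n (n + p) c f →
      (Casorati.IsEinstein n M ↔ Casorati.IsTotallyGeodesic n (n + p) f)) := by
  refine ⟨fun hI => ⟨fun hE => hf.isTotallyGeodesic_of_idealHat hn hN hE hI, ?_⟩,
    fun hI => ⟨fun hE => hf.isTotallyGeodesic_of_ideal hn hN hE hI, ?_⟩⟩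
  all_goals exact hf.isEinstein_of_isTotallyGeodesic hN
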